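/- Let $K$ be a field of characteristic $0$, let $\mathrm{GW}(K)$ be its Grothendieck–Witt ring (the Grothendieck group of the monoid, under direct sum, of isomorphism classes of finite-dimensional $K$-vector spaces with a nondegenerate symmetric bilinear form, with multiplication induced by the tensor product). For $a\in K^\times$ let $\langle a\rangle$ be the class of $K$ with the form $(x,y)\mapsto axy$, and let $\mathbb H=\langle 1\rangle+\langle -1\rangle$. For an integer $w\ge 1$ put $m(w)=\frac{w-1}{2}\,\mathbb H+\langle w\rangle$ if $w$ is odd and $m(w)=\frac w2\,\mathbb H$ if $w$ is even. A *floor diagram of degree $d$* is a loopless multigraph $\mathcal D$ (possibly disconnected) on the vertex set $\{1,\dots,d\}$, with edges oriented towards the larger vertex and weighted by positive integers, such that at every vertex the divergence (total weight of incoming edges minus total weight of outgoing edges) is at most $1$; diagrams that differ only by renaming edges are identified. Its genus is $g(\mathcal D)=\#\text{edges}-d+1$ and its cogenus is $\delta(\mathcal D)=\frac{(d-1)(d-2)}2-g(\mathcal D)$. A *marking* of $\mathcal D$ is obtained as follows: call the vertices of $\mathcal D$ white; insert a black vertex in the middle of each edge, the two new edges inheriting weight and orientation; add $d$ further black vertices,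 each with one outgoing edge of weight $1$ ending in a white vertex, so that every white vertex has divergence exactly $1$; and extend the order of the white vertices to a total order on all vertices that is compatible with the orientation of all edges. Two markings are equivalent if there is an order-preserving isomorphism of weighted graphs between them that fixes the white vertices; $\nu(\mathcal D)$ denotes the number of markings up to equivalence. The arithmetic multiplicity of $\mathcal D$ is the product of $m(w(e))$ over all edges $e$ of a marking of $\mathcal D$, so that every edge of weight $w$ of $\mathcal D$ contributes $m(w)^2$ and every added edge contributes $m(1)=\langle 1\rangle$. Set $$N^{\delta}_{\mathbb A^1}(d)=\sum_{\mathcal D}\nu(\mathcal D)\,\mathrm{mult}_{\mathbb A^1}(\mathcal D)\in\mathrm{GW}(K),$$ the sum running over all floor diagrams of degree $d$ and cogenus $\delta$. **Theorem.** Let $K$ be a field of characteristic $0$. For every integer $\delta\ge 0$ there are polynomials $P,Q\in\mathbb Q[d]$ of degree $2\delta$ (where, for $P$ in the case $\delta=0$, the zero polynomial is allowed and counts as having degree $0$) such that for all sufficiently large integers $d$ the values $P(d)$ and $Q(d)$ are integers and $$N^{\delta}_{\mathbb A^1}(d)=P(d)\,\mathbb H+Q(d)\,\langle 1\rangle .$$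 -/

import Mathlib

open scoped TensorProduct

universe u

/-! ### The Grothendieck–Witt ring of a field -/

/-- A quadratic space over `K`: a finite-dimensional vector space with a nondegenerate symmetric
bilinear form. -/
structure QuadSpace (K : Type u) [Field K] where
  V : Type u
  [addCommGroup : AddCommGroup V]
  [module : Module K V]
  [finite : FiniteDimensional K V]
  form : LinearMap.BilinForm K V
  symm : ∀ x y, form x y = form y x
  nondeg : form.Nondegenerate

attribute [instance] QuadSpace.addCommGroup QuadSpace.module QuadSpace.finite

namespace QuadSpace

variable {K : Type u} [Field K]

theorem nondeg_of_symm {V : Type u} [AddCommGroup V] [Module K V] (B : LinearMap.BilinForm K V)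
    (hs : ∀ x y, B x y = B y x) (h : ∀ x, (∀ y, B x y = 0) → x = 0) : B.Nondegenerate :=
  ⟨fun x hx => h x hx, fun y hy => h y fun x => by rw [hs]; exact hy x⟩

/-- Two quadratic spaces are isomorphic if there is a linear isomorphism preserving the forms. -/
def Iso (A B : QuadSpace K) : Prop :=
  ∃ e : A.V ≃ₗ[K] B.V, ∀ x y, B.form (e x) (e y) = A.form x y

instance isoSetoid (K : Type u) [Field K] : Setoid (QuadSpace K) where
  r := Iso
  iseqv :=
    { refl := fun A => ⟨LinearEquiv.refl K A.V, fun _ _ => rfl⟩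
      symm := fun {A B} ⟨e, he⟩ => ⟨e.symm, fun x y => by
        rw [← he, e.apply_symm_apply, e.apply_symm_apply]⟩
      trans := fun {A B C} ⟨e, he⟩ ⟨f, hf⟩ => ⟨e.trans f, fun x y => by
        rw [LinearEquiv.trans_apply, LinearEquiv.trans_apply, hf, he]⟩ }

/-- The zero space. -/
@[reducible]
def zero (K : Type u) [Field K] : QuadSpace K where
  V := PUnit.{u+1}
  form := 0
  symm := fun _ _ => rfl
  nondeg := nondeg_of_symm _ (fun _ _ => rfl) fun _ _ => rfl

/-- The one-dimensional space `⟨a⟩`, that is, `K` with the form `(x, y) ↦ a * x * y`. -/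
@[reducible]
def diag (a : Kˣ) : QuadSpace K where
  V := K
  form := (a : K) • LinearMap.mul K K
  symm := fun x y => by simp [mul_comm]
  nondeg := nondeg_of_symm _ (fun x y => by simp [mul_comm]) fun x hx => by
    simpa using hx 1

/-- Orthogonal direct sum. -/
@[reducible]
def sum (A B : QuadSpace K) : QuadSpace K where
  V := A.V × B.V
  form := A.form.compl₁₂ (LinearMap.fst K A.V B.V) (LinearMap.fst K A.V B.V) +
    B.form.compl₁₂ (LinearMap.snd K A.V B.V) (LinearMap.snd K A.V B.V)
  symm := fun x y => by simp [A.symm x.1, B.symm x.2]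
  nondeg := nondeg_of_symm _ (fun x y => by simp [A.symm x.1, B.symm x.2]) fun x hx => by
    refine Prod.ext (A.nondeg.1 x.1 fun y => ?_) (B.nondeg.1 x.2 fun y => ?_)
    · simpa using hx (y, 0)
    · simpa using hx (0, y)

theorem sum_form (A B : QuadSpace K) (x y : A.V × B.V) :
    (A.sum B).form x y = A.form x.1 y.1 + B.form x.2 y.2 := rfl

theorem tmul_symm (A B : QuadSpace K) (x y : A.V ⊗[K] B.V) :
    LinearMap.BilinForm.tmul A.form B.form x y = LinearMap.BilinForm.tmul A.form B.form y x :=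
  (LinearMap.IsSymm.tmul ⟨A.symm⟩ ⟨B.symm⟩).eq x y

theorem tmul_inj (A B : QuadSpace K) (x : A.V ⊗[K] B.V)
    (hx : ∀ y, LinearMap.BilinForm.tmul A.form B.form x y = 0) : x = 0 := by
  have key : (LinearMap.BilinForm.tmul A.form B.form : A.V ⊗[K] B.V →ₗ[K] _) =
      (TensorProduct.dualDistribEquiv K A.V B.V).toLinearMap ∘ₗ
        (TensorProduct.congr (A.form.toDual A.nondeg) (B.form.toDual B.nondeg)).toLinearMap := by
    apply TensorProduct.ext'
    intro a b
    apply TensorProduct.ext'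
    intro c d
    simp [TensorProduct.dualDistribEquiv, TensorProduct.dualDistribEquivOfBasis,
      LinearMap.BilinForm.toDual_def, mul_comm]
  have h0 : LinearMap.BilinForm.tmul A.form B.form x = 0 := LinearMap.ext hx
  rw [key, LinearMap.comp_apply, LinearEquiv.coe_coe, LinearEquiv.coe_coe,
    LinearEquiv.map_eq_zero_iff, LinearEquiv.map_eq_zero_iff] at h0
  exact h0

/-- Tensor product; the form is determined by
`(a ⊗ b, a' ⊗ b') ↦ A.form a a' * B.form b b'`. -/
@[reducible]
noncomputable def tensor (A B : QuadSpace K) : QuadSpace K where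
  V := A.V ⊗[K] B.V
  form := LinearMap.BilinForm.tmul A.form B.form
  symm := tmul_symm A B
  nondeg := nondeg_of_symm _ (tmul_symm A B) (tmul_inj A B)

theorem tensor_form (A B : QuadSpace K) (a a' : A.V) (b b' : B.V) :
    (A.tensor B).form (a ⊗ₜ[K] b) (a' ⊗ₜ[K] b') = A.form a a' * B.form b b' := by
  simp [mul_comm]

/-- To compare two forms it suffices to compare them on pure tensors. -/
theorem form_ext_tensor {A B C : QuadSpace K} (e : A.V ⊗[K] B.V →ₗ[K] C.V)
    (h : ∀ a b a' b', C.form (e (a ⊗ₜ[K] b)) (e (a' ⊗ₜ[K] b')) = A.form a a' * B.form b b')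
    (x y : A.V ⊗[K] B.V) : C.form (e x) (e y) = (A.tensor B).form x y := by
  have : C.form.compl₁₂ e e = (A.tensor B).form := by
    apply TensorProduct.ext'
    intro a b
    apply TensorProduct.ext'
    intro a' b'
    rw [tensor_form]
    exact h a b a' b'
  exact LinearMap.congr_fun (LinearMap.congr_fun this x) y

theorem sum_congr {A A' B B' : QuadSpace K} (hA : Iso A A') (hB : Iso B B') :
    Iso (A.sum B) (A'.sum B') := by
  obtain ⟨e, he⟩ := hA
  obtain ⟨f, hf⟩ := hB
  refine ⟨LinearEquiv.prodCongr e f, fun x y => ?_⟩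
  rw [sum_form, sum_form, ← he, ← hf]; rfl

theorem tensor_congr {A A' B B' : QuadSpace K} (hA : Iso A A') (hB : Iso B B') :
    Iso (A.tensor B) (A'.tensor B') := by
  obtain ⟨e, he⟩ := hA
  obtain ⟨f, hf⟩ := hB
  refine ⟨TensorProduct.congr e f, fun x y => ?_⟩
  refine form_ext_tensor (C := A'.tensor B') (TensorProduct.congr e f).toLinearMap ?_ x y
  intro a b a' b'
  rw [← he, ← hf]
  exact tensor_form _ _ _ _ _ _

theorem sum_comm (A B : QuadSpace K) : Iso (A.sum B) (B.sum A) :=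
  ⟨LinearEquiv.prodComm K A.V B.V, fun x y => by
    rw [sum_form, sum_form]; exact add_comm _ _⟩

theorem sum_assoc (A B C : QuadSpace K) : Iso ((A.sum B).sum C) (A.sum (B.sum C)) :=
  ⟨LinearEquiv.prodAssoc K A.V B.V C.V, fun x y => by
    exact (add_assoc _ _ _).symm⟩

theorem zero_sum (A : QuadSpace K) : Iso ((zero K).sum A) A :=
  ⟨LinearEquiv.uniqueProd (R := K) (M := A.V) (M₂ := PUnit.{u+1}), fun x y => by
    rw [sum_form]; exact (zero_add _).symm⟩

theorem tensor_comm (A B : QuadSpace K) : Iso (A.tensor B) (B.tensor A) := by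
  refine ⟨TensorProduct.comm K A.V B.V, fun x y => ?_⟩
  refine form_ext_tensor (C := B.tensor A) (TensorProduct.comm K A.V B.V).toLinearMap ?_ x y
  intro a b a' b'
  exact (tensor_form _ _ _ _ _ _).trans (mul_comm _ _)

theorem tensor_assoc (A B C : QuadSpace K) :
    Iso ((A.tensor B).tensor C) (A.tensor (B.tensor C)) := by
  let e := TensorProduct.assoc K A.V B.V C.V
  refine ⟨e, fun x y => ?_⟩
  have : ((A.tensor (B.tensor C)).form.compl₁₂ e.toLinearMap e.toLinearMap :
      LinearMap.BilinForm K ((A.V ⊗[K] B.V) ⊗[K] C.V)) = ((A.tensor B).tensor C).form := by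
    apply TensorProduct.ext_threefold
    intro a b c
    apply TensorProduct.ext_threefold
    intro a' b' c'
    refine (tensor_form A (B.tensor C) a a' (b ⊗ₜ c) (b' ⊗ₜ c')).trans ?_
    refine Eq.trans ?_ (tensor_form (A.tensor B) C (a ⊗ₜ b) (a' ⊗ₜ b') c c').symm
    rw [tensor_form, tensor_form, mul_assoc]
  exact LinearMap.congr_fun (LinearMap.congr_fun this x) y

theorem one_tensor (A : QuadSpace K) : Iso ((diag 1).tensor A) A := by
  refine ⟨TensorProduct.lid K A.V, fun x y => ?_⟩
  refine form_ext_tensor (A := diag 1) (C := A) (TensorProduct.lid K A.V).toLinearMap ?_ x y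
  intro a b a' b'
  simp [mul_assoc, mul_left_comm]

theorem zero_tensor (A : QuadSpace K) : Iso ((zero K).tensor A) (zero K) := by
  have h : ∀ x : PUnit.{u+1} ⊗[K] A.V, x = 0 := fun x => by
    induction x using TensorProduct.induction_on with
    | zero => rfl
    | tmul a b => rw [Subsingleton.elim a 0, TensorProduct.zero_tmul]
    | add x y hx hy => rw [hx, hy, add_zero]
  have : Subsingleton (((zero K).tensor A).V) := ⟨fun x y => (h x).trans (h y).symm⟩
  have : Subsingleton ((zero K).V) := inferInstanceAs (Subsingleton PUnit.{u+1})
  refine ⟨0, fun x y => ?_⟩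
  rw [Subsingleton.elim x 0]; simp

theorem sum_tensor (A B C : QuadSpace K) :
    Iso ((A.sum B).tensor C) ((A.tensor C).sum (B.tensor C)) := by
  let e : (A.V × B.V) ⊗[K] C.V ≃ₗ[K] (A.V ⊗[K] C.V) × (B.V ⊗[K] C.V) :=
    TensorProduct.prodLeft K K A.V B.V C.V
  refine ⟨e, fun x y => ?_⟩
  refine form_ext_tensor (A := A.sum B) (C := (A.tensor C).sum (B.tensor C)) e.toLinearMap ?_ x y
  rintro ⟨a, b⟩ c ⟨a', b'⟩ c'
  refine (sum_form (A.tensor C) (B.tensor C) (a ⊗ₜ c, b ⊗ₜ c) (a' ⊗ₜ c', b' ⊗ₜ c')).trans ?_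
  rw [tensor_form, tensor_form, sum_form, add_mul]

end QuadSpace

/-- Isomorphism classes of quadratic spaces over `K`. -/
def QuadClass (K : Type u) [Field K] : Type (u + 1) := Quotient (QuadSpace.isoSetoid K)

noncomputable instance QuadClass.instAdd (K : Type u) [Field K] : Add (QuadClass K) :=
  ⟨Quotient.map₂ QuadSpace.sum fun _ _ h _ _ h' => QuadSpace.sum_congr h h'⟩

noncomputable instance QuadClass.instZero (K : Type u) [Field K] : Zero (QuadClass K) :=
  ⟨Quotient.mk _ (QuadSpace.zero K)⟩

noncomputable instance QuadClass.instMul (K : Type u) [Field K] : Mul (QuadClass K) :=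
  ⟨Quotient.map₂ QuadSpace.tensor fun _ _ h _ _ h' => QuadSpace.tensor_congr h h'⟩

noncomputable instance QuadClass.instOne (K : Type u) [Field K] : One (QuadClass K) :=
  ⟨Quotient.mk _ (QuadSpace.diag 1)⟩

/-- Isomorphism classes form a commutative semiring under direct sum and tensor product. -/
noncomputable instance QuadClass.instCommSemiring (K : Type u) [Field K] :
    CommSemiring (QuadClass K) where
  nsmul := nsmulRec
  npow := npowRec
  add_comm := by rintro ⟨a⟩ ⟨b⟩; exact Quotient.sound (QuadSpace.sum_comm a b)
  add_assoc := by rintro ⟨a⟩ ⟨b⟩ ⟨c⟩; exact Quotient.sound (QuadSpace.sum_assoc a b c)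
  zero_add := by rintro ⟨a⟩; exact Quotient.sound (QuadSpace.zero_sum a)
  add_zero := by
    rintro ⟨a⟩
    exact Quotient.sound (Setoid.trans (QuadSpace.sum_comm a _) (QuadSpace.zero_sum a))
  mul_comm := by rintro ⟨a⟩ ⟨b⟩; exact Quotient.sound (QuadSpace.tensor_comm a b)
  mul_assoc := by rintro ⟨a⟩ ⟨b⟩ ⟨c⟩; exact Quotient.sound (QuadSpace.tensor_assoc a b c)
  one_mul := by rintro ⟨a⟩; exact Quotient.sound (QuadSpace.one_tensor a)
  mul_one := by
    rintro ⟨a⟩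
    exact Quotient.sound (Setoid.trans (QuadSpace.tensor_comm a _) (QuadSpace.one_tensor a))
  zero_mul := by rintro ⟨a⟩; exact Quotient.sound (QuadSpace.zero_tensor a)
  mul_zero := by
    rintro ⟨a⟩
    exact Quotient.sound (Setoid.trans (QuadSpace.tensor_comm a _) (QuadSpace.zero_tensor a))
  right_distrib := by
    rintro ⟨a⟩ ⟨b⟩ ⟨c⟩; exact Quotient.sound (QuadSpace.sum_tensor a b c)
  left_distrib := by
    rintro ⟨a⟩ ⟨b⟩ ⟨c⟩
    exact Quotient.sound (Setoid.trans (QuadSpace.tensor_comm a _)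
      (Setoid.trans (QuadSpace.sum_tensor b c a)
        (QuadSpace.sum_congr (QuadSpace.tensor_comm b a) (QuadSpace.tensor_comm c a))))

/-- The Grothendieck–Witt ring: the Grothendieck group of the additive monoid of isomorphism
classes of quadratic spaces. -/
def GW (K : Type u) [Field K] : Type (u + 1) := Algebra.GrothendieckAddGroup (QuadClass K)

namespace GW

variable {K : Type u} [Field K]

noncomputable instance instAddCommGroup : AddCommGroup (GW K) :=
  inferInstanceAs (AddCommGroup (Algebra.GrothendieckAddGroup (QuadClass K)))

/-- The canonical additive map from isomorphism classes to the Grothendieck group. -/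
noncomputable def of : QuadClass K →+ GW K :=
  (Algebra.GrothendieckAddGroup.of : QuadClass K →+ Algebra.GrothendieckAddGroup (QuadClass K))

/-- Additive maps to a group extend uniquely to the Grothendieck group. -/
noncomputable def lift {G : Type*} [AddCommGroup G] (f : QuadClass K →+ G) : GW K →+ G :=
  (Algebra.GrothendieckAddGroup.lift f : Algebra.GrothendieckAddGroup (QuadClass K) →+ G)

theorem lift_of {G : Type*} [AddCommGroup G] (f : QuadClass K →+ G) (s : QuadClass K) :
    lift f (of s) = f s :=
  DFunLike.congr_fun (Algebra.GrothendieckAddGroup.lift.symm_apply_apply f) s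

theorem hom_ext {G : Type*} [AddCommGroup G] {f g : GW K →+ G}
    (h : ∀ s, f (of s) = g (of s)) : f = g :=
  Algebra.GrothendieckAddGroup.lift.symm.injective (AddMonoidHom.ext h)

/-- The biadditive multiplication on the Grothendieck group that extends the tensor product. -/
noncomputable def mulHom (K : Type u) [Field K] : GW K →+ GW K →+ GW K :=
  lift
    { toFun := fun s => lift (of.comp (AddMonoidHom.mulLeft s))
      map_zero' := hom_ext fun t => by simp [lift_of]
      map_add' := fun a b => hom_ext fun t => by simp [lift_of, add_mul] }

theorem mulHom_of (s t : QuadClass K) : mulHom K (of s) (of t) = of (s * t) := by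
  simp [mulHom, lift_of]

theorem mulHom_comm : (mulHom K).flip = mulHom K :=
  hom_ext fun s => hom_ext fun t => by
    rw [AddMonoidHom.flip_apply, mulHom_of, mulHom_of, mul_comm]

theorem mulHom_assoc (x y z : GW K) :
    mulHom K (mulHom K x y) z = mulHom K x (mulHom K y z) := by
  have h : (AddMonoidHom.compHom (mulHom K)).comp (mulHom K) =
      (AddMonoidHom.compHom.flip (mulHom K)).comp
        (AddMonoidHom.compHom.comp (mulHom K)) := by
    refine hom_ext fun s => hom_ext fun t => hom_ext fun r => ?_
    simp [mulHom_of, mul_assoc]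
  exact DFunLike.congr_fun (DFunLike.congr_fun (DFunLike.congr_fun h x) y) z

theorem one_mulHom : mulHom K (of 1) = AddMonoidHom.id (GW K) :=
  hom_ext fun s => by rw [mulHom_of, one_mul]; rfl

noncomputable instance instMul : Mul (GW K) := ⟨fun x y => mulHom K x y⟩

noncomputable instance instOne : One (GW K) := ⟨of 1⟩

/-- The ring structure on the Grothendieck–Witt group induced by the tensor product. -/
noncomputable instance instCommRing : CommRing (GW K) where
  __ := instAddCommGroup
  npow := npowRec
  mul_comm := fun x y => (DFunLike.congr_fun (DFunLike.congr_fun mulHom_comm x) y).symm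
  mul_assoc := mulHom_assoc
  one_mul := fun x => DFunLike.congr_fun one_mulHom x
  mul_one := fun x => (DFunLike.congr_fun (DFunLike.congr_fun mulHom_comm (of 1)) x).trans
    (DFunLike.congr_fun one_mulHom x)
  zero_mul := fun x => by
    change mulHom K 0 x = 0
    simp
  mul_zero := fun x => by
    change mulHom K x 0 = 0
    simp
  left_distrib := fun x y z => map_add (mulHom K x) y z
  right_distrib := fun x y z => by
    change mulHom K (x + y) z = mulHom K x z + mulHom K y z
    simp

/-- The class `⟨a⟩`. -/
noncomputable def diag (a : Kˣ) : GW K := of (Quotient.mk _ (QuadSpace.diag a))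

/-- The hyperbolic plane `⟨1⟩ + ⟨-1⟩`. -/
noncomputable def hyp (K : Type u) [Field K] : GW K := diag 1 + diag (-1)

end GW

/-! ### Floor diagrams of plane curves of degree `d` -/

/-- A weighted oriented edge `src → tgt` between elements of the vertex set `{1, …, d}`, which is
modelled by `Fin d`. -/
@[ext]
structure WEdge (d : ℕ) where
  src : Fin d
  tgt : Fin d
  wt : ℕ

noncomputable instance WEdge.instDecidableEq (d : ℕ) : DecidableEq (WEdge d) :=
  Classical.decEq _

/-- The divergence at `v`: total incoming weight minus total outgoing weight. -/
noncomputable def edgeDiv {d : ℕ} (E : Multiset (WEdge d)) (v : Fin d) : ℤ :=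
  (E.map fun e => if e.tgt = v then (e.wt : ℤ) else 0).sum -
    (E.map fun e => if e.src = v then (e.wt : ℤ) else 0).sum

/-- A floor diagram of degree `d` (for the triangle with vertices `(0,0)`, `(0,d)`, `(d,0)`): a
loopless multigraph on `d` ordered vertices, with positive integer edge weights and with edges
oriented towards the larger vertex, such that every vertex has divergence at most `1`. A multigraph
with a fixed vertex set is, up to renaming the edges, the multiset of its weighted edges. -/
@[ext]
structure FloorDiagram (d : ℕ) where
  edges : Multiset (WEdge d)
  src_lt_tgt : ∀ e ∈ edges, e.src < e.tgt
  wt_pos : ∀ e ∈ edges, 1 ≤ e.wt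
  div_le : ∀ v, edgeDiv edges v ≤ 1

namespace FloorDiagram

variable {d : ℕ}

/-- The genus `1 - χ` of the underlying graph, that is, `#edges - #vertices + 1`. For a connected
graph it is the first Betti number; diagrams that are not connected are allowed, as the curves that
they count may be reducible. -/
def genus (D : FloorDiagram d) : ℤ := (D.edges.card : ℤ) - d + 1

/-- The cogenus (number of nodes) `(d - 1)(d - 2)/2 - g`. -/
def cogenus (D : FloorDiagram d) : ℤ := ((d : ℤ) - 1) * ((d : ℤ) - 2) / 2 - D.genus

/-- There are only finitely many floor diagrams of given degree. -/
instance instFinite (d : ℕ) : Finite (FloorDiagram d) := by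
  classical
  -- the sum of all weights is at most `∑ v, v`
  have hsum : ∀ E : Multiset (WEdge d), (∑ v : Fin d, (v : ℤ) * edgeDiv E v) =
      (E.map fun e => (e.wt : ℤ) * ((e.tgt : ℤ) - (e.src : ℤ))).sum := by
    intro E
    induction E using Multiset.induction_on with
    | empty => simp [edgeDiv]
    | cons a s ih =>
      have h1 : ∀ v : Fin d, edgeDiv (a ::ₘ s) v = edgeDiv s v +
          ((if a.tgt = v then (a.wt : ℤ) else 0) - (if a.src = v then (a.wt : ℤ) else 0)) := by
        intro v; simp only [edgeDiv, Multiset.map_cons, Multiset.sum_cons]; ring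
      simp only [h1, mul_add, Finset.sum_add_distrib, ih, Multiset.map_cons, Multiset.sum_cons,
        mul_sub, Finset.sum_sub_distrib, mul_ite, mul_zero, Finset.sum_ite_eq, Finset.mem_univ,
        if_true]
      ring
  have hle : ∀ D : FloorDiagram d, (D.edges.map fun e => e.wt).sum ≤ ∑ v : Fin d, (v : ℕ) := by
    intro D
    have h1 : (D.edges.map fun e => (e.wt : ℤ)).sum ≤
        (D.edges.map fun e => (e.wt : ℤ) * ((e.tgt : ℤ) - (e.src : ℤ))).sum := by
      apply Multiset.sum_map_le_sum_map
      intro e he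
      have := D.src_lt_tgt e he
      have h2 : (1 : ℤ) ≤ (e.tgt : ℤ) - (e.src : ℤ) := by
        have : (e.src : ℕ) < (e.tgt : ℕ) := this
        omega
      nlinarith [Int.natCast_nonneg e.wt]
    have h2 : (∑ v : Fin d, (v : ℤ) * edgeDiv D.edges v) ≤ ∑ v : Fin d, (v : ℤ) := by
      apply Finset.sum_le_sum
      intro v _
      have := D.div_le v
      have h0 : (0 : ℤ) ≤ (v : ℤ) := Int.natCast_nonneg _
      nlinarith
    rw [← hsum] at h1
    have h3 := h1.trans h2
    have h4 : (((D.edges.map fun e => e.wt).sum : ℕ) : ℤ) = (D.edges.map fun e => (e.wt : ℤ)).sum := by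
      exact (map_multiset_sum (Nat.castRingHom ℤ) _).trans (by rw [Multiset.map_map]; rfl)
    rw [← h4] at h3
    exact_mod_cast h3
  set N := ∑ v : Fin d, (v : ℕ) with hN
  have hwt : ∀ D : FloorDiagram d, ∀ e ∈ D.edges, e.wt ≤ N := fun D e he =>
    (Multiset.single_le_sum (fun _ _ => Nat.zero_le _) _
      (Multiset.mem_map_of_mem (fun e : WEdge d => e.wt) he)).trans (hle D)
  have hcard : ∀ D : FloorDiagram d, ∀ e, D.edges.count e ≤ N := by
    intro D e
    refine (Multiset.count_le_card _ _).trans (le_trans ?_ (hle D))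
    have := Multiset.card_nsmul_le_sum (s := D.edges.map fun e => e.wt) (a := 1)
      (fun x hx => by
        obtain ⟨e, he, rfl⟩ := Multiset.mem_map.1 hx
        exact D.wt_pos e he)
    simpa using this
  let F : FloorDiagram d → (Fin d × Fin d × Fin (N + 1) → Fin (N + 1)) := fun D p =>
    ⟨D.edges.count ⟨p.1, p.2.1, p.2.2⟩, Nat.lt_succ_of_le (hcard D _)⟩
  refine Finite.of_injective F fun D D' h => ?_
  apply FloorDiagram.ext
  apply Multiset.ext.2
  intro e
  by_cases hw : e.wt ≤ N
  · have := congrArg Fin.val (congrFun h (e.src, e.tgt, ⟨e.wt, Nat.lt_succ_of_le hw⟩))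
    exact this
  · rw [Multiset.count_eq_zero_of_notMem (fun he => hw (hwt D e he)),
      Multiset.count_eq_zero_of_notMem (fun he => hw (hwt D' e he))]

noncomputable instance instFintype (d : ℕ) : Fintype (FloorDiagram d) := Fintype.ofFinite _

/-- The vertices of a marked floor diagram: the `d` white vertices (first summand), one black vertex
in the middle of every edge (second summand), and one black vertex for each of the `d` left ends of
weight `1` (third summand). -/
abbrev MVertex (D : FloorDiagram d) : Type := Fin d ⊕ (D.edges ⊕ Fin d)

/-- A marking of a floor diagram, of the degree `d` in which all `d` left ends have weight `1` and
there are no right ends. -/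
structure Marking (D : FloorDiagram d) where
  /-- The white vertex at which the edge starting at the `i`-th left black vertex ends. -/
  target : Fin d → Fin d
  /-- After adding the left ends, every white vertex has divergence `1`. -/
  div_eq : ∀ v, edgeDiv D.edges v + (Finset.univ.filter fun i => target i = v).card = 1
  /-- A total order on all vertices, given as the increasing enumeration of the vertices. -/
  pos : D.MVertex ≃ Fin (Fintype.card D.MVertex)
  /-- The order extends the order of the white vertices. -/
  white_lt : ∀ v w : Fin d, v < w → pos (Sum.inl v) < pos (Sum.inl w)
  /-- The order is compatible with the orientation of all edges. -/
  src_lt : ∀ e : D.edges, pos (Sum.inl e.1.src) < pos (Sum.inr (Sum.inl e))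
  lt_tgt : ∀ e : D.edges, pos (Sum.inr (Sum.inl e)) < pos (Sum.inl e.1.tgt)
  end_lt : ∀ i : Fin d, pos (Sum.inr (Sum.inr i)) < pos (Sum.inl (target i))

/-- The graph underlying a marking: the weight of the edge from one vertex to another, or `0` if
there is no such edge. (The graph has no multiple edges.) -/
noncomputable def Marking.adj {D : FloorDiagram d} (M : D.Marking) : D.MVertex → D.MVertex → ℕ
  | Sum.inl v, Sum.inr (Sum.inl e) => if e.1.src = v then e.1.wt else 0
  | Sum.inr (Sum.inl e), Sum.inl v => if e.1.tgt = v then e.1.wt else 0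
  | Sum.inr (Sum.inr i), Sum.inl v => if M.target i = v then 1 else 0
  | _, _ => 0

/-- Two markings are equivalent if there is an isomorphism of weighted graphs between them that
fixes the white vertices (and respects the total orders, which are part of the markings). -/
instance markingSetoid (D : FloorDiagram d) : Setoid D.Marking where
  r M M' := ∃ σ : D.MVertex ≃ D.MVertex, (∀ v : Fin d, σ (Sum.inl v) = Sum.inl v) ∧
    (∀ x y, M'.adj (σ x) (σ y) = M.adj x y) ∧
    (∀ x y, M'.pos (σ x) < M'.pos (σ y) ↔ M.pos x < M.pos y)
  iseqv :=
    { refl := fun M => ⟨Equiv.refl _, fun _ => rfl, fun _ _ => rfl, fun _ _ => Iff.rfl⟩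
      symm := fun {M M'} ⟨σ, h1, h2, h3⟩ => ⟨σ.symm, fun v => by
          rw [Equiv.symm_apply_eq, h1], fun x y => by
          rw [← h2, σ.apply_symm_apply, σ.apply_symm_apply], fun x y => by
          rw [← h3, σ.apply_symm_apply, σ.apply_symm_apply]⟩
      trans := fun {M M' M''} ⟨σ, h1, h2, h3⟩ ⟨τ, k1, k2, k3⟩ => ⟨σ.trans τ, fun v => by
          rw [Equiv.trans_apply, h1, k1], fun x y => by
          rw [Equiv.trans_apply, Equiv.trans_apply, k2, h2], fun x y => by
          rw [Equiv.trans_apply, Equiv.trans_apply, k3, h3]⟩ }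

/-- The number `ν(D)` of markings up to equivalence. -/
noncomputable def nu (D : FloorDiagram d) : ℕ := Nat.card (Quotient D.markingSetoid)

end FloorDiagram

/-! ### Arithmetic multiplicities and the arithmetic count -/

/-- The arithmetic multiplicity of an edge of weight `w` (over a field of characteristic zero). -/
noncomputable def edgeMult (K : Type u) [Field K] [CharZero K] (w : ℕ) : GW K :=
  if h : Odd w then
    ((w - 1) / 2) • GW.hyp K + GW.diag (Units.mk0 (w : K) (Nat.cast_ne_zero.2 h.pos.ne'))
  else (w / 2) • GW.hyp K

/-- The arithmetic multiplicity of a floor diagram: the product of the multiplicities of all edges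
of the diagram after marking, where every edge of `D` is cut by a black vertex into two edges of the
same weight, and there are `d` further edges of weight `1` coming from the left ends. -/
noncomputable def FloorDiagram.mult (K : Type u) [Field K] [CharZero K] {d : ℕ}
    (D : FloorDiagram d) : GW K :=
  (D.edges.map fun e => edgeMult K e.wt * edgeMult K e.wt).prod * ∏ _i : Fin d, edgeMult K 1

open Classical in
/-- The arithmetic count of floor diagrams of degree `d` and cogenus `δ`. -/
noncomputable def arithmeticCount (K : Type u) [Field K] [CharZero K] (δ d : ℕ) : GW K :=
  ∑ D : FloorDiagram d with D.cogenus = (δ : ℤ), D.nu • D.mult K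

/-!
In characteristic zero `m(w)²` is `p ℍ + s ⟨1⟩` with `2 p + s = w²` and `s = 1` or `s = 0` according
to the parity of `w`. Classes of this form are determined by the pair `(2 p + s, s)`, which behaves
multiplicatively, so it suffices to show that for every `f : ℕ → ℤ` with `f 1 = 1` the number of
marked floor diagrams, counted with a factor `f w` for each edge of weight `w`, is eventually a
polynomial in `d` with coefficient `((f 2 + 2) / 2) ^ δ / δ!` in degree `2 δ`.

A marking up to equivalence is a word: for every gap in front of a white vertex, the list of the
black vertices in it. A black vertex is recorded as a segment, that is, by how far its edge extends
to both sides and by its weight. The divergence condition says that the segments cross each gap with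
a prescribed total weight, which grows linearly with the index of the gap, and the cogenus is the
sum of the excesses of the segments. Only segments of weight one that cross a single gap have excess
zero. Their number in each gap is forced, and they can be shuffled with the `m` other segments of a
gap in a number of ways that is a polynomial of degree `m` in the index of the gap. As the total
excess is `δ`, all but boundedly many gaps are trivial. Summing over the positions of the
nontrivial gaps gives the polynomial, and its top degree comes from `δ` gaps that hold a single
segment of excess one each, of which there are three kinds, of weights `2`, `1` and `1`.
-/

theorem QuadSpace.iso_of_isometry {K : Type u} [Field K] {A B : QuadSpace K} (f : A.V →ₗ[K] B.V)
    (hf : ∀ x y, B.form (f x) (f y) = A.form x y)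
    (h : Module.finrank K A.V = Module.finrank K B.V) : Iso A B := by
  have injective : Function.Injective f := (injective_iff_map_eq_zero f).2 fun x hx =>
    A.nondeg.1 x fun y => by rw [← hf, hx, map_zero, LinearMap.zero_apply]
  exact ⟨LinearMap.linearEquivOfInjective f injective h, hf⟩

namespace GW

variable {K : Type u} [Field K]

theorem diag_one : diag (1 : Kˣ) = 1 := rfl

theorem diag_mul_diag (a b : Kˣ) : diag a * diag b = diag (a * b) := by
  refine (mulHom_of _ _).trans (congrArg of (Quotient.sound ⟨TensorProduct.lid K K, fun x y => ?_⟩))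
  refine QuadSpace.form_ext_tensor (A := QuadSpace.diag a) (B := QuadSpace.diag b)
    (C := QuadSpace.diag (a * b)) (TensorProduct.lid K K).toLinearMap (fun c d c' d' => ?_) x y
  simp only [LinearMap.smul_apply, LinearMap.mul_apply', Units.val_mul, LinearEquiv.coe_coe,
    TensorProduct.lid_tmul, smul_eq_mul]
  ring

theorem diag_mul_self (a : Kˣ) : diag (a * a) = 1 := by
  refine congrArg of (Quotient.sound
    (QuadSpace.iso_of_isometry (LinearMap.mulLeft K (a : K)) (fun x y => ?_) rfl))
  simp only [LinearMap.smul_apply, LinearMap.mul_apply', LinearMap.mulLeft_apply, Units.val_one,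
    Units.val_mul, smul_eq_mul]
  ring

theorem diag_add_diag (a b : Kˣ) :
    diag a + diag b = of (Quotient.mk _ ((QuadSpace.diag a).sum (QuadSpace.diag b))) :=
  let class_a : QuadClass K := Quotient.mk _ (QuadSpace.diag a)
  let class_b : QuadClass K := Quotient.mk _ (QuadSpace.diag b)
  (map_add of class_a class_b).symm

section Hyperbolic

variable [NeZero (2 : K)]

theorem diag_add_diag_neg (a : Kˣ) : diag a + diag (-a) = hyp K := by
  rw [hyp, diag_add_diag, diag_add_diag]
  refine congrArg of (Quotient.sound ?_)
  have two : (2 : K) ≠ 0 := two_ne_zero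
  -- `a x² - a y² = a (x + y) (x - y)`, so the isometry sends `(x, y)` to the vector `(s, t)` with
  -- `s + t = a (x + y)` and `s - t = x - y`.
  let f : K × K →ₗ[K] K × K :=
    { toFun := fun z => ((a * (z.1 + z.2) + (z.1 - z.2)) / 2, (a * (z.1 + z.2) - (z.1 - z.2)) / 2)
      map_add' := fun x y => by ext <;> simp <;> ring
      map_smul' := fun c x => by ext <;> simp <;> ring }
  refine QuadSpace.iso_of_isometry f (fun x y => ?_) rfl
  change ((1 : Kˣ) : K) • ((f x).1 * (f y).1) + ((-1 : Kˣ) : K) • ((f x).2 * (f y).2) =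
    (a : K) • (x.1 * y.1) + ((-a : Kˣ) : K) • (x.2 * y.2)
  simp only [f, LinearMap.coe_mk, AddHom.coe_mk, Units.val_one, Units.val_neg, smul_eq_mul]
  field_simp
  ring

theorem hyp_mul_diag (a : Kˣ) : hyp K * diag a = hyp K := by
  calc hyp K * diag a = diag a + diag (-a) := by
        rw [hyp, add_mul, diag_mul_diag, diag_mul_diag, one_mul, neg_one_mul]
    _ = hyp K := diag_add_diag_neg a

theorem hyp_mul_hyp : hyp K * hyp K = 2 * hyp K := by
  calc hyp K * hyp K = hyp K * (diag 1 + diag (-1)) := rfl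
    _ = 2 * hyp K := by rw [mul_add, hyp_mul_diag, hyp_mul_diag, two_mul]

end Hyperbolic

/-- The element `x` is of the form `p ℍ + s ⟨1⟩` with `2 p + s = r`. The integers `r` and `s` are
then the rank and, for an ordered field, the signature of `x`; unlike `p` they are both
multiplicative. -/
def HasRankSignature (x : GW K) (r s : ℤ) : Prop :=
  ∃ p : ℤ, 2 * p + s = r ∧ x = p • hyp K + s • diag (1 : Kˣ)

namespace HasRankSignature

variable {x y : GW K} {r s r' s' : ℤ}

theorem zero : HasRankSignature (0 : GW K) 0 0 := ⟨0, by simp, by simp⟩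

theorem one : HasRankSignature (1 : GW K) 1 1 := ⟨0, by simp, by simp [diag_one]⟩

theorem add (hx : HasRankSignature x r s) (hy : HasRankSignature y r' s') :
    HasRankSignature (x + y) (r + r') (s + s') := by
  obtain ⟨p, rfl, rfl⟩ := hx
  obtain ⟨p', rfl, rfl⟩ := hy
  exact ⟨p + p', by ring, by rw [add_smul, add_smul, add_add_add_comm]⟩

theorem nsmul (hx : HasRankSignature x r s) (n : ℕ) : HasRankSignature (n • x) (n * r) (n * s) := by
  obtain ⟨p, rfl, rfl⟩ := hx
  refine ⟨n * p, by ring, ?_⟩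
  rw [smul_add, ← natCast_zsmul, ← natCast_zsmul, smul_smul, smul_smul]

theorem sum {ι : Type*} {t : Finset ι} {x : ι → GW K} {r s : ι → ℤ}
    (h : ∀ i ∈ t, HasRankSignature (x i) (r i) (s i)) :
    HasRankSignature (∑ i ∈ t, x i) (∑ i ∈ t, r i) (∑ i ∈ t, s i) := by
  induction t using Finset.cons_induction with
  | empty => exact zero
  | cons i t hi ih =>
    simp only [Finset.sum_cons]
    exact (h i (Finset.mem_cons_self i t)).add (ih fun j hj => h j (Finset.mem_cons_of_mem hj))

variable [NeZero (2 : K)]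

theorem mul (hx : HasRankSignature x r s) (hy : HasRankSignature y r' s') :
    HasRankSignature (x * y) (r * r') (s * s') := by
  obtain ⟨p, rfl, rfl⟩ := hx
  obtain ⟨p', rfl, rfl⟩ := hy
  refine ⟨2 * p * p' + p * s' + s * p', by ring, ?_⟩
  simp only [zsmul_eq_mul, diag_one]
  push_cast
  linear_combination (p : GW K) * p' * hyp_mul_hyp (K := K)

theorem multiset_prod_map {α : Type*} {x : α → GW K} {r s : α → ℤ}
    (h : ∀ a, HasRankSignature (x a) (r a) (s a)) (t : Multiset α) :
    HasRankSignature (t.map x).prod (t.map r).prod (t.map s).prod := by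
  induction t using Multiset.induction_on with
  | empty => exact one
  | cons a t ih =>
    simp only [Multiset.map_cons, Multiset.prod_cons]
    exact (h a).mul ih

end HasRankSignature

end GW

open Classical in
/-- The number of marked floor diagrams of degree `d` and cogenus `δ`, where each edge of weight `w`
contributes a factor `f w`. For `f w = w ^ 2` this is the count of complex curves. -/
noncomputable def FloorDiagram.weightedCount {R : Type*} [CommSemiring R] (f : ℕ → R) (δ d : ℕ) :
    R :=
  ∑ D : FloorDiagram d with D.cogenus = (δ : ℤ), D.nu * (D.edges.map fun e => f e.wt).prod

theorem FloorDiagram.map_weightedCount {R S : Type*} [CommSemiring R] [CommSemiring S] (φ : R →+* S)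
    (f : ℕ → R) (δ d : ℕ) :
    φ (weightedCount f δ d) = weightedCount (fun w => φ (f w)) δ d := by
  simp [weightedCount, map_multiset_prod]

section ArithmeticMultiplicity

variable (K : Type u) [Field K] [CharZero K]

theorem edgeMult_one : edgeMult K 1 = 1 := by
  simp [edgeMult, GW.diag_one]

theorem hasRankSignature_edgeMult_mul_self (w : ℕ) :
    (edgeMult K w * edgeMult K w).HasRankSignature ((w : ℤ) ^ 2) (if Odd w then 1 else 0) := by
  have hyp_sq := GW.hyp_mul_hyp (K := K)
  rcases Nat.even_or_odd' w with ⟨k, rfl | rfl⟩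
  · have not_odd : ¬Odd (2 * k) := by simp
    refine ⟨2 * k * k, by simp only [if_neg not_odd]; push_cast; ring, ?_⟩
    rw [edgeMult, dif_neg not_odd, if_neg not_odd, Nat.mul_div_cancel_left k two_pos]
    simp only [nsmul_eq_mul, zsmul_eq_mul]
    push_cast
    linear_combination (k : GW K) ^ 2 * hyp_sq
  · have odd : Odd (2 * k + 1) := ⟨k, rfl⟩
    refine ⟨2 * k * k + 2 * k, by simp only [if_pos odd]; push_cast; ring, ?_⟩
    rw [edgeMult, dif_pos odd, if_pos odd, Nat.add_sub_cancel, Nat.mul_div_cancel_left k two_pos]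
    set u : Kˣ := Units.mk0 ((2 * k + 1 : ℕ) : K) _
    have u_sq : GW.diag u * GW.diag u = 1 := by rw [GW.diag_mul_diag, GW.diag_mul_self]
    simp only [nsmul_eq_mul, zsmul_eq_mul, GW.diag_one]
    push_cast
    linear_combination (k : GW K) ^ 2 * hyp_sq + 2 * (k : GW K) * GW.hyp_mul_diag u + u_sq

theorem FloorDiagram.hasRankSignature_mult {d : ℕ} (D : FloorDiagram d) :
    (D.mult K).HasRankSignature (D.edges.map fun e => (e.wt : ℤ) ^ 2).prod
      (D.edges.map fun e => if Odd e.wt then (1 : ℤ) else 0).prod := by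
  simpa only [FloorDiagram.mult, edgeMult_one, Finset.prod_const_one, mul_one] using
    GW.HasRankSignature.multiset_prod_map
      (fun e : WEdge d => hasRankSignature_edgeMult_mul_self K e.wt) D.edges

theorem hasRankSignature_arithmeticCount (δ d : ℕ) :
    (arithmeticCount K δ d).HasRankSignature
      (FloorDiagram.weightedCount (fun w => (w : ℤ) ^ 2) δ d)
      (FloorDiagram.weightedCount (fun w => if Odd w then (1 : ℤ) else 0) δ d) :=
  GW.HasRankSignature.sum fun D _ => (D.hasRankSignature_mult K).nsmul D.nu

end ArithmeticMultiplicity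

open Filter Polynomial in
/-- The sequence `u` agrees for large `n` with a polynomial of degree at most `d` whose coefficient
in degree `d` is `c`, possibly zero. -/
def EventuallyPoly (u : ℕ → ℚ) (d : ℕ) (c : ℚ) : Prop :=
  ∃ p : ℚ[X], p.natDegree ≤ d ∧ p.coeff d = c ∧ ∀ᶠ n : ℕ in atTop, u n = p.eval (n : ℚ)

namespace EventuallyPoly

open Filter Polynomial

variable {u v : ℕ → ℚ} {d d' : ℕ} {c c' : ℚ}

theorem congr (hu : EventuallyPoly u d c) (h : ∀ᶠ n : ℕ in atTop, v n = u n) :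
    EventuallyPoly v d c := by
  obtain ⟨p, deg_p, coeff_p, eval_p⟩ := hu
  exact ⟨p, deg_p, coeff_p, by filter_upwards [h, eval_p] with n h₁ h₂ using h₁.trans h₂⟩

theorem const (c : ℚ) : EventuallyPoly (fun _ => c) 0 c :=
  ⟨C c, by simp, by simp, by simp⟩

theorem zero (d : ℕ) : EventuallyPoly (fun _ => 0) d 0 :=
  ⟨0, by simp, by simp, by simp⟩

theorem add (hu : EventuallyPoly u d c) (hv : EventuallyPoly v d c') :
    EventuallyPoly (fun n => u n + v n) d (c + c') := by
  obtain ⟨p, deg_p, coeff_p, eval_p⟩ := hu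
  obtain ⟨q, deg_q, coeff_q, eval_q⟩ := hv
  refine ⟨p + q, natDegree_add_le_of_degree_le deg_p deg_q, by rw [coeff_add, coeff_p, coeff_q], ?_⟩
  filter_upwards [eval_p, eval_q] with n hp hq
  rw [eval_add, hp, hq]

theorem mul (hu : EventuallyPoly u d c) (hv : EventuallyPoly v d' c') :
    EventuallyPoly (fun n => u n * v n) (d + d') (c * c') := by
  obtain ⟨p, deg_p, coeff_p, eval_p⟩ := hu
  obtain ⟨q, deg_q, coeff_q, eval_q⟩ := hv
  refine ⟨p * q, natDegree_mul_le_of_le deg_p deg_q, ?_, ?_⟩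
  · rw [coeff_mul_add_eq_of_natDegree_le deg_p deg_q, coeff_p, coeff_q]
  · filter_upwards [eval_p, eval_q] with n hp hq
    rw [eval_mul, hp, hq]

theorem const_mul (a : ℚ) (hu : EventuallyPoly u d c) :
    EventuallyPoly (fun n => a * u n) d (a * c) := by
  simpa only [zero_add] using (const a).mul hu

theorem sub (hu : EventuallyPoly u d c) (hv : EventuallyPoly v d c') :
    EventuallyPoly (fun n => u n - v n) d (c - c') := by
  simpa only [neg_one_mul, ← sub_eq_add_neg] using hu.add (hv.const_mul (-1))

theorem of_lt (hu : EventuallyPoly u d c) (h : d < d') : EventuallyPoly u d' 0 := by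
  obtain ⟨p, deg_p, -, eval_p⟩ := hu
  exact ⟨p, by omega, coeff_eq_zero_of_natDegree_lt (by omega), eval_p⟩

theorem sum {ι : Type*} (s : Finset ι) {u : ι → ℕ → ℚ} {c : ι → ℚ}
    (h : ∀ i ∈ s, EventuallyPoly (u i) d (c i)) :
    EventuallyPoly (fun n => ∑ i ∈ s, u i n) d (∑ i ∈ s, c i) := by
  induction s using Finset.cons_induction with
  | empty => simpa using zero d
  | cons i s hi ih =>
    simp only [Finset.sum_cons]
    exact (h i (Finset.mem_cons_self i s)).add (ih fun j hj => h j (Finset.mem_cons_of_mem hj))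

theorem coeff_taylor_of_natDegree_le {p : ℚ[X]} (h : p.natDegree ≤ d) (r : ℚ) :
    (taylor r p).coeff d = p.coeff d := by
  rcases h.lt_or_eq with h | rfl
  · rw [coeff_eq_zero_of_natDegree_lt h, coeff_eq_zero_of_natDegree_lt (by simpa using h)]
  · exact coeff_taylor_natDegree r p

theorem comp_add_right (hu : EventuallyPoly u d c) (k : ℕ) :
    EventuallyPoly (fun n => u (n + k)) d c := by
  obtain ⟨p, deg_p, coeff_p, eval_p⟩ := hu
  refine ⟨taylor (k : ℚ) p, by simpa using deg_p, ?_, ?_⟩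
  · rw [← coeff_p]
    exact coeff_taylor_of_natDegree_le deg_p k
  · filter_upwards [(tendsto_add_atTop_nat k).eventually eval_p] with n hn
    rw [hn, taylor_eval, Nat.cast_add]

theorem of_comp_add_right (k : ℕ) (hu : EventuallyPoly (fun n => u (n + k)) d c) :
    EventuallyPoly u d c := by
  obtain ⟨p, deg_p, coeff_p, eval_p⟩ := hu
  refine ⟨taylor (-k : ℚ) p, by simpa using deg_p, ?_, ?_⟩
  · rw [← coeff_p]
    exact coeff_taylor_of_natDegree_le deg_p _
  · filter_upwards [(tendsto_sub_atTop_nat k).eventually eval_p, eventually_ge_atTop k] with n hn hk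
    rw [Nat.sub_add_cancel hk] at hn
    rw [hn, taylor_eval, Nat.cast_sub hk, sub_eq_add_neg]

theorem choose_sub_add (x m : ℕ) :
    EventuallyPoly (fun n => ((n - x + m).choose m : ℚ)) m (m.factorial : ℚ)⁻¹ := by
  refine ⟨preHilbertPoly ℚ m x, (natDegree_preHilbertPoly ℚ m x).le,
    coeff_preHilbertPoly_self ℚ m x, ?_⟩
  filter_upwards [eventually_ge_atTop x] with n hn
  exact (preHilbertPoly_eq_choose_sub_add ℚ m hn).symm

/-- Bernoulli polynomials are antidifferences of monomials. -/
theorem exists_antidifference {p : ℚ[X]} (hp : p.natDegree ≤ d) :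
    ∃ q : ℚ[X], q.natDegree ≤ d + 1 ∧ q.coeff (d + 1) = p.coeff d / (d + 1) ∧
      ∀ x : ℚ, q.eval (1 + x) - q.eval x = p.eval x := by
  let q : ℚ[X] := ∑ i ∈ Finset.range (d + 1), C (p.coeff i / (i + 1)) * Polynomial.bernoulli (i + 1)
  have natDegree_bernoulli_le : ∀ i, (Polynomial.bernoulli i).natDegree ≤ i := fun i =>
    natDegree_le_iff_coeff_eq_zero.2 fun j hj => by rw [coeff_bernoulli, if_neg (by omega)]
  refine ⟨q, ?_, ?_, fun x => ?_⟩
  · refine natDegree_sum_le_of_forall_le _ _ fun i hi => (natDegree_C_mul_le _ _).trans ?_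
    exact (natDegree_bernoulli_le _).trans (Finset.mem_range.1 hi)
  · rw [finsetSum_coeff, Finset.sum_range_succ, Finset.sum_eq_zero fun i hi => ?_]
    · simp [coeff_bernoulli]
    · have deg_lt : (Polynomial.bernoulli (i + 1)).natDegree < d + 1 :=
        (natDegree_bernoulli_le _).trans_lt (Nat.succ_lt_succ (Finset.mem_range.1 hi))
      rw [coeff_C_mul, coeff_eq_zero_of_natDegree_lt deg_lt, mul_zero]
  · rw [eval_finsetSum, eval_finsetSum, ← Finset.sum_sub_distrib,
      eval_eq_sum_range' (Nat.lt_succ_of_le hp)]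
    refine Finset.sum_congr rfl fun i _ => ?_
    rw [eval_mul, eval_mul, eval_C, eval_C, bernoulli_eval_one_add, Nat.add_sub_cancel,
      Nat.cast_succ]
    field_simp
    ring

theorem of_difference (hv : EventuallyPoly v d c)
    (h : ∀ᶠ n : ℕ in atTop, u (n + 1) - u n = v n) :
    EventuallyPoly u (d + 1) (c / (d + 1)) := by
  obtain ⟨p, deg_p, coeff_p, eval_p⟩ := hv
  obtain ⟨q, deg_q, coeff_q, difference_q⟩ := exists_antidifference deg_p
  obtain ⟨N, hN⟩ := eventually_atTop.1 (h.and eval_p)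
  refine ⟨q + C (u N - q.eval (N : ℚ)), natDegree_add_le_of_degree_le deg_q (by simp), ?_, ?_⟩
  · rw [coeff_add, coeff_q, coeff_C_succ, coeff_p, add_zero]
  · filter_upwards [eventually_ge_atTop N] with n hn
    induction n, hn using Nat.le_induction with
    | base => simp
    | succ n hn ih =>
      have difference_u := hN n hn
      have difference_q := difference_q n
      simp only [eval_add, eval_C] at ih ⊢
      rw [Nat.cast_succ, add_comm (n : ℚ) 1]
      linarith

end EventuallyPoly

section Sequences

variable {α : Type*} {n k : ℕ}

/-- The sequence `F` preceded by the entry `s`. -/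
def seqCons (s : α) (F : ℕ → α) : ℕ → α
  | 0 => s
  | i + 1 => F i

/-- The sequence `F` preceded by the entries of the tuple `M`. -/
def seqAppend (M : Fin n → α) (F : ℕ → α) (i : ℕ) : α :=
  if h : i < n then M ⟨i, h⟩ else F (i - n)

theorem seqAppend_lt (M : Fin n → α) (F : ℕ → α) (i : Fin n) : seqAppend M F i = M i :=
  dif_pos i.2

theorem seqAppend_ge (M : Fin n → α) (F : ℕ → α) {i : ℕ} (h : n ≤ i) :
    seqAppend M F i = F (i - n) :=
  dif_neg h.not_gt

theorem seqAppend_snoc (M : Fin n → α) (s : α) (F : ℕ → α) :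
    seqAppend (Fin.snoc (α := fun _ => α) M s) F = seqAppend M (seqCons s F) := by
  funext i
  rcases lt_trichotomy i n with h | rfl | h
  · exact (seqAppend_lt _ F ⟨i, h.trans n.lt_succ_self⟩).trans <|
      (Fin.snoc_castSucc (α := fun _ => α) s M ⟨i, h⟩).trans (seqAppend_lt M _ ⟨i, h⟩).symm
  · rw [seqAppend_ge M _ le_rfl, Nat.sub_self]
    exact (seqAppend_lt _ F (Fin.last i)).trans (Fin.snoc_last (α := fun _ => α) s M)
  · rw [seqAppend_ge _ F h, seqAppend_ge M _ h.le, ← Nat.sub_add_cancel (Nat.sub_pos_of_lt h)]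
    exact congrArg F (Nat.sub_succ' i n)

theorem seqAppend_append (M : Fin n → α) (M' : Fin k → α) (F : ℕ → α) :
    seqAppend (Fin.append M M') F = seqAppend M (seqAppend M' F) := by
  funext i
  rcases lt_or_ge i n with h | h
  · exact (seqAppend_lt _ F ⟨i, h.trans_le (n.le_add_right k)⟩).trans <|
      (Fin.append_left M M' ⟨i, h⟩).trans (seqAppend_lt M _ ⟨i, h⟩).symm
  obtain ⟨j, rfl⟩ := Nat.exists_eq_add_of_le h
  rw [seqAppend_ge M _ h, Nat.add_sub_cancel_left]
  rcases lt_or_ge j k with hj | hj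
  · exact (seqAppend_lt _ F (Fin.natAdd n ⟨j, hj⟩)).trans <|
      (Fin.append_right M M' ⟨j, hj⟩).trans (seqAppend_lt M' F ⟨j, hj⟩).symm
  · rw [seqAppend_ge _ F (by omega), seqAppend_ge M' F hj, Nat.add_sub_add_left]

theorem seqAppend_const (s : α) : seqAppend (fun _ : Fin n => s) (fun _ => s) = fun _ => s := by
  funext i
  simp only [seqAppend, dite_eq_ite, ite_self]

theorem seqCons_const (s : α) : seqCons s (fun _ => s) = fun _ => s := by
  funext i
  cases i <;> rfl

end Sequences

/-- Data for a weighted count of the ways to fill every gap `0, 1, 2, …` with an element of the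
finite type `S`: the weight of a filling is a product of contributions of the single gaps, and the
contribution of a gap involves only the gaps at distance less than `range`.

Far from the end `0`, the contribution of a gap is a polynomial in its index, whose degree `size s`
and leading coefficient `lead s` depend only on the element `s` in that gap. -/
structure LocalModel where
  S : Type
  [fintype : Fintype S]
  empty : S
  range : ℕ
  size : S → ℕ
  excess : S → ℕ
  lead : S → ℚ
  /-- The contribution of a gap to the weight of a filling. -/
  weight : (ℕ → S) → ℕ → ℚ
  /-- Whether an element may fill the gap at a given distance from the upper end. -/
  topAdm : S → ℕ → Prop
  size_empty : size empty = 0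
  excess_empty : excess empty = 0
  lead_empty : lead empty = 1
  size_pos : ∀ s, s ≠ empty → 0 < size s
  size_le_excess : ∀ s, size s ≤ excess s
  weight_congr : ∀ {F F' : ℕ → S} {g : ℕ},
    (∀ i, g < i + range → i < g + range → F i = F' i) → weight F g = weight F' g
  weight_empty : ∀ g, weight (fun _ => empty) g = 1
  eventuallyPoly_weight : ∀ F : ℕ → S, EventuallyPoly
    (fun n => weight (fun i => F (i - n)) (n + range)) (size (F range)) (lead (F range))
  topAdm_far : ∀ s i, range ≤ i → topAdm s i
  topAdm_empty : ∀ i, topAdm empty i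

namespace LocalModel

attribute [instance] LocalModel.fintype

variable (𝓜 : LocalModel)

/-- The filling by the empty element only. -/
def emptySeq : ℕ → 𝓜.S := fun _ => 𝓜.empty

/-- The contribution of gap `n + range` to the fillings that are given by `F` from gap `n` on. -/
def boundaryWeight (F : ℕ → 𝓜.S) (n : ℕ) : ℚ := 𝓜.weight (fun i => F (i - n)) (n + 𝓜.range)

/-- The weighted number of fillings of total excess `e` of the gaps below `n`, given the filling `F`
of the gaps from `n` on, where only the contributions of the gaps below `n + range` are counted. -/
def partialSum (n e : ℕ) (F : ℕ → 𝓜.S) : ℚ :=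
  ∑ M : Fin n → 𝓜.S with ∑ i, 𝓜.excess (M i) = e,
    ∏ g ∈ Finset.range (n + 𝓜.range), 𝓜.weight (seqAppend M F) g

open Classical in
/-- The admissible fillings of total excess `e` of the gaps below `d`. -/
noncomputable def fillings (d e : ℕ) : Finset (Fin d → 𝓜.S) :=
  {M | (∑ i, 𝓜.excess (M i) = e) ∧ ∀ i : Fin d, 𝓜.topAdm (M i) (d - 1 - i)}

/-- The weighted number of admissible fillings of total excess `e` of the gaps below `d`. -/
noncomputable def count (d e : ℕ) : ℚ :=
  ∑ M ∈ 𝓜.fillings d e, ∏ g ∈ Finset.range d, 𝓜.weight (seqAppend M 𝓜.emptySeq) g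

/-- The sum of the leading coefficients of the elements of excess one. -/
def unitCount : ℚ := ∑ s : 𝓜.S with 𝓜.excess s = 1, 𝓜.lead s

/-- The leading coefficient, as a polynomial in the number of gaps, of the weighted number of
fillings of total excess `e`. -/
def leadCoeff (e : ℕ) : ℚ := (𝓜.unitCount / 2) ^ e / (e.factorial : ℚ)

variable {𝓜}

/-- The total degree of the contributions that the first gaps of `F` still have to make to
`LocalModel.partialSum`. -/
def pendingSize (F : ℕ → 𝓜.S) : ℕ := ∑ i ∈ Finset.range 𝓜.range, 𝓜.size (F i)

/-- The leading coefficient of the product of the contributions that the first gaps of `F` still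
have to make to `LocalModel.partialSum`. -/
def pendingCoeff (F : ℕ → 𝓜.S) : ℚ := ∏ i ∈ Finset.range 𝓜.range, 𝓜.lead (F i)

/-- The asymptotic behaviour of `LocalModel.partialSum` for the total excess `e` and the boundary
filling `F`. -/
def HasExpectedGrowth (e : ℕ) (F : ℕ → 𝓜.S) : Prop :=
  EventuallyPoly (fun n => 𝓜.partialSum n e F) (2 * e + pendingSize F)
    (𝓜.leadCoeff e * pendingCoeff F)

theorem mem_fillings {d e : ℕ} {M : Fin d → 𝓜.S} : M ∈ 𝓜.fillings d e ↔
    (∑ i, 𝓜.excess (M i) = e) ∧ ∀ i : Fin d, 𝓜.topAdm (M i) (d - 1 - i) := by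
  simp [fillings]

theorem excess_pos {s : 𝓜.S} (hs : s ≠ 𝓜.empty) : 0 < 𝓜.excess s :=
  (𝓜.size_pos s hs).trans_le (𝓜.size_le_excess s)

theorem sum_excess_pos {n : ℕ} {M : Fin n → 𝓜.S} (hM : M ≠ fun _ => 𝓜.empty) :
    0 < ∑ i, 𝓜.excess (M i) := by
  obtain ⟨i, hi⟩ := Function.ne_iff.1 hM
  exact Finset.sum_pos' (fun _ _ => Nat.zero_le _) ⟨i, Finset.mem_univ i, excess_pos hi⟩

theorem weight_seqAppend {n : ℕ} (M : Fin n → 𝓜.S) (F : ℕ → 𝓜.S) :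
    𝓜.weight (seqAppend M F) (n + 𝓜.range) = 𝓜.boundaryWeight F n :=
  𝓜.weight_congr fun _ h _ => seqAppend_ge M F (by omega)

theorem partialSum_succ (n e : ℕ) (F : ℕ → 𝓜.S) :
    𝓜.partialSum (n + 1) e F = ∑ s : 𝓜.S with 𝓜.excess s ≤ e,
      𝓜.boundaryWeight (seqCons s F) n * 𝓜.partialSum n (e - 𝓜.excess s) (seqCons s F) := by
  have sum_excess_snoc (M : Fin n → 𝓜.S) (s : 𝓜.S) :
      ∑ i, 𝓜.excess (Fin.snoc (α := fun _ => 𝓜.S) M s i) =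
        (∑ i, 𝓜.excess (M i)) + 𝓜.excess s := by
    simp only [Fin.sum_univ_castSucc, Fin.snoc_castSucc, Fin.snoc_last]
  have snocEquiv_mk (M : Fin n → 𝓜.S) (s : 𝓜.S) :
      Fin.snocEquiv (fun _ => 𝓜.S) (s, M) = Fin.snoc (α := fun _ => 𝓜.S) M s := rfl
  simp only [partialSum, Finset.sum_filter]
  rw [← (Fin.snocEquiv fun _ => 𝓜.S).sum_comp, Fintype.sum_prod_type]
  refine Finset.sum_congr rfl fun s _ => ?_
  simp only [snocEquiv_mk, sum_excess_snoc, seqAppend_snoc]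
  split_ifs with hs
  · rw [Finset.mul_sum]
    refine Finset.sum_congr rfl fun M _ => ?_
    rw [mul_ite, mul_zero, Nat.add_right_comm, Finset.prod_range_succ, weight_seqAppend, mul_comm]
    exact if_congr (by omega) rfl rfl
  · exact Finset.sum_eq_zero fun M _ => if_neg (by omega)

open Classical in
theorem partialSum_succ_sub (n e : ℕ) :
    𝓜.partialSum (n + 1) e 𝓜.emptySeq - 𝓜.partialSum n e 𝓜.emptySeq =
      ∑ s : 𝓜.S with 𝓜.excess s ≤ e ∧ s ≠ 𝓜.empty, 𝓜.boundaryWeight (seqCons s 𝓜.emptySeq) n *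
        𝓜.partialSum n (e - 𝓜.excess s) (seqCons s 𝓜.emptySeq) := by
  have empty_mem : 𝓜.empty ∈ Finset.univ.filter fun s : 𝓜.S => 𝓜.excess s ≤ e := by
    simp [𝓜.excess_empty]
  have cons_empty : seqCons 𝓜.empty 𝓜.emptySeq = 𝓜.emptySeq := seqCons_const _
  have boundaryWeight_empty : 𝓜.boundaryWeight 𝓜.emptySeq n = 1 := 𝓜.weight_empty _
  rw [partialSum_succ, ← Finset.add_sum_erase _ _ empty_mem, cons_empty, boundaryWeight_empty,
    one_mul, 𝓜.excess_empty, Nat.sub_zero, add_sub_cancel_left]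
  refine Finset.sum_congr (Finset.ext fun s => ?_) fun _ _ => rfl
  simp only [Finset.mem_erase, Finset.mem_filter_univ, and_comm]

theorem partialSum_congr (n e : ℕ) {F F' : ℕ → 𝓜.S} (h : ∀ i < 2 * 𝓜.range, F i = F' i) :
    𝓜.partialSum n e F = 𝓜.partialSum n e F' := by
  refine Finset.sum_congr rfl fun M _ => Finset.prod_congr rfl fun g hg => ?_
  have g_lt := Finset.mem_range.1 hg
  refine 𝓜.weight_congr fun i _ hi => ?_
  rcases lt_or_ge i n with hn | hn
  · exact (seqAppend_lt M F ⟨i, hn⟩).trans (seqAppend_lt M F' ⟨i, hn⟩).symm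
  · rw [seqAppend_ge M F hn, seqAppend_ge M F' hn, h _ (by omega)]

theorem pendingSize_seqCons (s : 𝓜.S) (F : ℕ → 𝓜.S) :
    𝓜.size (seqCons s F 𝓜.range) + pendingSize (seqCons s F) = 𝓜.size s + pendingSize F := by
  rw [pendingSize, pendingSize, add_comm, ← Finset.sum_range_succ fun i => 𝓜.size (seqCons s F i),
    Finset.sum_range_succ', add_comm]
  rfl

theorem pendingCoeff_seqCons (s : 𝓜.S) (F : ℕ → 𝓜.S) :
    𝓜.lead (seqCons s F 𝓜.range) * pendingCoeff (seqCons s F) = 𝓜.lead s * pendingCoeff F := by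
  rw [pendingCoeff, pendingCoeff, mul_comm,
    ← Finset.prod_range_succ fun i => 𝓜.lead (seqCons s F i), Finset.prod_range_succ', mul_comm]
  rfl

theorem pendingSize_emptySeq : pendingSize 𝓜.emptySeq = 0 := by
  simp only [pendingSize, emptySeq, 𝓜.size_empty, Finset.sum_const_zero]

theorem pendingCoeff_emptySeq : pendingCoeff 𝓜.emptySeq = 1 := by
  simp only [pendingCoeff, emptySeq, 𝓜.lead_empty, Finset.prod_const_one]

namespace HasExpectedGrowth

variable {e : ℕ} {F F' : ℕ → 𝓜.S}

theorem congr (hF : HasExpectedGrowth e F) (h : ∀ i < 2 * 𝓜.range, F' i = F i) :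
    HasExpectedGrowth e F' := by
  have pendingSize_eq : pendingSize F' = pendingSize F := Finset.sum_congr rfl fun i hi => by
    rw [h i (by have := Finset.mem_range.1 hi; omega)]
  have pendingCoeff_eq : pendingCoeff F' = pendingCoeff F := Finset.prod_congr rfl fun i hi => by
    rw [h i (by have := Finset.mem_range.1 hi; omega)]
  rw [HasExpectedGrowth, pendingSize_eq, pendingCoeff_eq]
  simp only [partialSum_congr _ e h]
  exact hF

theorem mul_boundaryWeight {s : 𝓜.S} (h : HasExpectedGrowth e (seqCons s F)) :
    EventuallyPoly (fun n => 𝓜.boundaryWeight (seqCons s F) n * 𝓜.partialSum n e (seqCons s F))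
      (2 * e + 𝓜.size s + pendingSize F) (𝓜.leadCoeff e * (𝓜.lead s * pendingCoeff F)) := by
  rw [add_assoc, ← pendingSize_seqCons, ← pendingCoeff_seqCons, add_left_comm, mul_left_comm]
  exact (𝓜.eventuallyPoly_weight (seqCons s F)).mul h

theorem zero_emptySeq : HasExpectedGrowth 0 𝓜.emptySeq := by
  have partialSum_zero (n : ℕ) : 𝓜.partialSum n 0 𝓜.emptySeq = 1 := by
    rw [partialSum, Finset.sum_eq_single_of_mem (fun _ => 𝓜.empty)]
    · refine Finset.prod_eq_one fun g _ => ?_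
      exact (congrArg (𝓜.weight · g) (seqAppend_const _)).trans (𝓜.weight_empty g)
    · simp [𝓜.excess_empty]
    · intro M hM hne
      exact absurd (Finset.mem_filter.1 hM).2 (sum_excess_pos hne).ne'
  simpa [HasExpectedGrowth, partialSum_zero, pendingSize_emptySeq, pendingCoeff_emptySeq, leadCoeff]
    using EventuallyPoly.const 1

/-- The elements of larger excess contribute polynomials of smaller degree, so the leading
coefficient involves only the elements of excess one. -/
theorem eventuallyPoly_difference (ih : ∀ e' ≤ e, ∀ F : ℕ → 𝓜.S, HasExpectedGrowth e' F) :
    EventuallyPoly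
      (fun n => 𝓜.partialSum (n + 1) (e + 1) 𝓜.emptySeq - 𝓜.partialSum n (e + 1) 𝓜.emptySeq)
      (2 * e + 1) (𝓜.unitCount * 𝓜.leadCoeff e) := by
  classical
  have lead_sum : 𝓜.unitCount * 𝓜.leadCoeff e = ∑ s : 𝓜.S with
      𝓜.excess s ≤ e + 1 ∧ s ≠ 𝓜.empty,
        if 𝓜.excess s = 1 then 𝓜.lead s * 𝓜.leadCoeff e else 0 := by
    rw [unitCount, Finset.sum_mul, ← Finset.sum_filter]
    refine Finset.sum_congr (Finset.ext fun s => ?_) fun _ _ => rfl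
    have excess_empty := 𝓜.excess_empty
    grind
  simp only [partialSum_succ_sub]
  rw [lead_sum]
  refine EventuallyPoly.sum _ fun s hs => ?_
  obtain ⟨excess_le, s_ne⟩ := (Finset.mem_filter.1 hs).2
  have excess_pos := excess_pos s_ne
  have size_pos := 𝓜.size_pos s s_ne
  have size_le := 𝓜.size_le_excess s
  have growth := (ih (e + 1 - 𝓜.excess s) (by omega) (seqCons s 𝓜.emptySeq)).mul_boundaryWeight
  rw [pendingSize_emptySeq, pendingCoeff_emptySeq, mul_one, add_zero] at growth
  split_ifs with excess_eq
  · have size_eq : 𝓜.size s = 1 := by omega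
    rw [excess_eq, Nat.add_sub_cancel, size_eq, mul_comm (𝓜.leadCoeff e)] at growth
    rwa [excess_eq, Nat.add_sub_cancel]
  · exact growth.of_lt (by omega)

theorem succ_emptySeq (ih : ∀ e' ≤ e, ∀ F : ℕ → 𝓜.S, HasExpectedGrowth e' F) :
    HasExpectedGrowth (e + 1) 𝓜.emptySeq := by
  have leadCoeff_succ :
      𝓜.leadCoeff (e + 1) = 𝓜.unitCount * 𝓜.leadCoeff e / ((2 * e + 1 : ℕ) + 1 : ℚ) := by
    rw [leadCoeff, leadCoeff, Nat.factorial_succ]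
    push_cast
    field_simp
    ring
  rw [HasExpectedGrowth, pendingSize_emptySeq, pendingCoeff_emptySeq, mul_one, leadCoeff_succ]
  exact (eventuallyPoly_difference ih).of_difference (Filter.Eventually.of_forall fun _ => rfl)

theorem of_seqCons_empty (ih : ∀ e' < e, ∀ F : ℕ → 𝓜.S, HasExpectedGrowth e' F)
    (hF : HasExpectedGrowth e (seqCons 𝓜.empty F)) : HasExpectedGrowth e F := by
  classical
  refine EventuallyPoly.of_comp_add_right 1 ?_
  have lead_sum : 𝓜.leadCoeff e * pendingCoeff F = ∑ s : 𝓜.S with 𝓜.excess s ≤ e,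
      if s = 𝓜.empty then 𝓜.leadCoeff e * pendingCoeff F else 0 := by
    rw [Finset.sum_ite_eq', if_pos (by simp [𝓜.excess_empty])]
  simp only [partialSum_succ]
  rw [lead_sum]
  refine EventuallyPoly.sum _ fun s hs => ?_
  split_ifs with s_eq
  · subst s_eq
    simpa only [𝓜.excess_empty, Nat.sub_zero, 𝓜.size_empty, add_zero, 𝓜.lead_empty, one_mul]
      using hF.mul_boundaryWeight
  · have excess_le : 𝓜.excess s ≤ e := (Finset.mem_filter.1 hs).2
    have excess_pos := excess_pos s_eq
    have size_le := 𝓜.size_le_excess s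
    exact (ih _ (by omega) (seqCons s F)).mul_boundaryWeight.of_lt (by omega)

theorem of_seqAppend_empty (ih : ∀ e' < e, ∀ F : ℕ → 𝓜.S, HasExpectedGrowth e' F) (k : ℕ)
    (hF : HasExpectedGrowth e (seqAppend (fun _ : Fin k => 𝓜.empty) F)) :
    HasExpectedGrowth e F := by
  induction k generalizing F with
  | zero => exact hF
  | succ k ihk =>
    refine of_seqCons_empty ih (ihk ?_)
    rwa [← seqAppend_snoc, show Fin.snoc (α := fun _ => 𝓜.S) (fun _ : Fin k => 𝓜.empty) 𝓜.empty =
      fun _ => 𝓜.empty from Fin.snoc_init_self fun _ : Fin (k + 1) => 𝓜.empty]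

end HasExpectedGrowth

/-- Putting the empty element sufficiently often in front of a boundary filling reduces to the empty
boundary filling, for which the difference in `n` involves only smaller excesses. -/
theorem hasExpectedGrowth (e : ℕ) (F : ℕ → 𝓜.S) : HasExpectedGrowth e F := by
  induction e using Nat.strong_induction_on generalizing F with
  | _ e ih =>
    have growth_emptySeq : HasExpectedGrowth e 𝓜.emptySeq := by
      cases e with
      | zero => exact .zero_emptySeq
      | succ e => exact .succ_emptySeq fun e' he' => ih e' (Nat.lt_succ_of_le he')
    refine .of_seqAppend_empty ih (2 * 𝓜.range) (growth_emptySeq.congr fun i hi => ?_)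
    exact seqAppend_lt _ F ⟨i, hi⟩

open Classical in
theorem count_add_range (n e : ℕ) :
    𝓜.count (n + 𝓜.range) e = ∑ M : Fin 𝓜.range → 𝓜.S with
      ∑ i, 𝓜.excess (M i) ≤ e ∧ ∀ i : Fin 𝓜.range, 𝓜.topAdm (M i) (𝓜.range - 1 - i),
        𝓜.partialSum n (e - ∑ i, 𝓜.excess (M i)) (seqAppend M 𝓜.emptySeq) := by
  have sum_excess_append (M : Fin n → 𝓜.S) (M' : Fin 𝓜.range → 𝓜.S) :
      ∑ i, 𝓜.excess (Fin.append M M' i) = (∑ i, 𝓜.excess (M i)) + ∑ i, 𝓜.excess (M' i) := by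
    simp only [Fin.sum_univ_add, Fin.append_left, Fin.append_right]
  have topAdm_append (M : Fin n → 𝓜.S) (M' : Fin 𝓜.range → 𝓜.S) :
      (∀ i : Fin (n + 𝓜.range), 𝓜.topAdm (Fin.append M M' i) (n + 𝓜.range - 1 - i)) ↔
        ∀ i : Fin 𝓜.range, 𝓜.topAdm (M' i) (𝓜.range - 1 - i) := by
    simp only [Fin.forall_fin_add, Fin.append_left, Fin.append_right, Fin.val_castAdd,
      Fin.val_natAdd]
    refine (and_iff_right fun i => 𝓜.topAdm_far _ _ (by omega)).trans (forall_congr' fun i => ?_)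
    rw [show n + 𝓜.range - 1 - (n + (i : ℕ)) = 𝓜.range - 1 - i by omega]
  simp only [count, fillings, partialSum, Finset.sum_filter]
  rw [← (Fin.appendEquiv n 𝓜.range).sum_comp, Fintype.sum_prod_type_right]
  refine Finset.sum_congr rfl fun M' _ => ?_
  simp only [Fin.appendEquiv, Equiv.coe_fn_mk, sum_excess_append, topAdm_append, seqAppend_append]
  split_ifs with hM'
  · refine Finset.sum_congr rfl fun M _ => if_congr ?_ rfl rfl
    rw [and_iff_left hM'.2, eq_tsub_iff_add_eq_of_le hM'.1]
  · exact Finset.sum_eq_zero fun M _ => if_neg fun h => hM' ⟨by omega, h.2⟩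

theorem pendingSize_seqAppend_le (M : Fin 𝓜.range → 𝓜.S) (F : ℕ → 𝓜.S) :
    pendingSize (seqAppend M F) ≤ ∑ i, 𝓜.excess (M i) := by
  rw [pendingSize, ← Fin.sum_univ_eq_sum_range fun i => 𝓜.size (seqAppend M F i)]
  refine Finset.sum_le_sum fun i _ => ?_
  rw [seqAppend_lt]
  exact 𝓜.size_le_excess _

theorem eventuallyPoly_count (𝓜 : LocalModel) (e : ℕ) :
    EventuallyPoly (fun d => 𝓜.count d e) (2 * e) (𝓜.leadCoeff e) := by
  classical
  refine EventuallyPoly.of_comp_add_right 𝓜.range ?_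
  have lead_sum : 𝓜.leadCoeff e = ∑ M : Fin 𝓜.range → 𝓜.S with
      ∑ i, 𝓜.excess (M i) ≤ e ∧ ∀ i : Fin 𝓜.range, 𝓜.topAdm (M i) (𝓜.range - 1 - i),
        if M = fun _ => 𝓜.empty then 𝓜.leadCoeff e else 0 := by
    rw [Finset.sum_ite_eq', if_pos (by simp [𝓜.excess_empty, 𝓜.topAdm_empty])]
  simp only [count_add_range]
  rw [lead_sum]
  refine EventuallyPoly.sum _ fun M hM => ?_
  have excess_le := (Finset.mem_filter.1 hM).2.1
  have growth := hasExpectedGrowth (e - ∑ i, 𝓜.excess (M i)) (seqAppend M 𝓜.emptySeq)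
  split_ifs with M_eq
  · subst M_eq
    have append_empty : seqAppend (fun _ : Fin 𝓜.range => 𝓜.empty) 𝓜.emptySeq = 𝓜.emptySeq :=
      seqAppend_const _
    rw [append_empty] at growth ⊢
    simpa [HasExpectedGrowth, pendingSize_emptySeq, pendingCoeff_emptySeq, 𝓜.excess_empty]
      using growth
  · have excess_pos := sum_excess_pos M_eq
    have pending_le := pendingSize_seqAppend_le M 𝓜.emptySeq
    exact EventuallyPoly.of_lt growth (by omega)

end LocalModel

section Lists

variable {α : Type*} [DecidableEq α] {o : α}

@[to_additive]
theorem prod_map_filter_ne_mul_pow_count {M : Type*} [CommMonoid M] (φ : α → M) (o : α)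
    (L : List α) : ((L.filter (· ≠ o)).map φ).prod * φ o ^ L.count o = (L.map φ).prod := by
  rw [← List.prod_map_filter_mul_prod_map_filter_not (· ≠ o) φ L]
  simp only [not_not, List.filter_eq, List.map_replicate, List.prod_replicate]

/-- The lists obtained from `l` by inserting `c` copies of `o`. -/
def shuffle (o : α) : ℕ → List α → Finset (List α)
  | 0, l => {l}
  | c + 1, [] => {List.replicate (c + 1) o}
  | c + 1, x :: l =>
    (shuffle o c (x :: l)).image (List.cons o) ∪ (shuffle o (c + 1) l).image (List.cons x)

theorem mem_shuffle {L l : List α} {c : ℕ} (ho : o ∉ l) :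
    L ∈ shuffle o c l ↔ L.filter (· ≠ o) = l ∧ L.count o = c := by
  induction L generalizing l c with
  | nil => cases c <;> cases l <;> simp [shuffle, List.replicate_succ, @eq_comm _ []]
  | cons y L ih =>
    rcases c with _ | c
    · rw [shuffle, Finset.mem_singleton, List.count_eq_zero]
      grind [List.filter_eq_self]
    rcases l with _ | ⟨x, l⟩
    · rw [shuffle, Finset.mem_singleton, List.eq_replicate_iff, List.filter_eq_nil_iff]
      grind [List.count_eq_length]
    have ho' : o ∉ l := List.not_mem_of_not_mem_cons ho
    simp only [shuffle, Finset.mem_union, Finset.mem_image]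
    rcases eq_or_ne y o with rfl | hy <;> grind

theorem card_shuffle {l : List α} (ho : o ∉ l) (c : ℕ) :
    (shuffle o c l).card = (c + l.length).choose l.length := by
  induction c generalizing l with
  | zero => simp [shuffle]
  | succ c ihc =>
    induction l with
    | nil => simp [shuffle]
    | cons x l ihl =>
      have ho' : o ∉ l := List.not_mem_of_not_mem_cons ho
      have images_disjoint : Disjoint ((shuffle o c (x :: l)).image (List.cons o))
          ((shuffle o (c + 1) l).image (List.cons x)) := by
        simp only [Finset.disjoint_left, Finset.mem_image]
        grind
      rw [shuffle, Finset.card_union_of_disjoint images_disjoint,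
        Finset.card_image_of_injective _ List.cons_injective,
        Finset.card_image_of_injective _ List.cons_injective, ihc ho, ihl ho', List.length_cons,
        ← add_assoc (c + 1), Nat.choose_succ_succ' (c + 1 + l.length), add_comm,
        ← add_assoc, add_right_comm c]

end Lists

/-- An edge of a floor diagram, seen from the gap between two consecutive white vertices in which
its black vertex lies: it passes `left` further gaps on the side of its source and `right` further
gaps on the side of its target. Gaps are numbered from the target side. -/
@[ext]
structure Segment where
  left : ℕ
  right : ℕ
  weight : ℕ
deriving DecidableEq

namespace Segment

/-- The sum of the weights of a segment over all gaps that it crosses. -/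
def area (x : Segment) : ℕ := x.weight * (x.left + x.right + 1)

/-- The contribution of a segment to the cogenus. -/
def excess (x : Segment) : ℕ := x.area - 1

/-- The weight with which a segment in gap `i` crosses gap `g`. -/
def cross (x : Segment) (i g : ℕ) : ℕ := if g ≤ i + x.left ∧ i ≤ g + x.right then x.weight else 0

/-- The segment of weight one that crosses a single gap. -/
def ordinary : Segment := ⟨0, 0, 1⟩

/-- The total excess of a list of segments. -/
def listExcess (L : List Segment) : ℕ := (L.map excess).sum

/-- The total weight with which a list of segments in gap `i` crosses gap `g`. -/
def listCross (L : List Segment) (i g : ℕ) : ℕ := (L.map fun x => x.cross i g).sum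

/-- The product of a function of the weight over a list of segments. -/
def listVal (f : ℕ → ℚ) (L : List Segment) : ℚ := (L.map fun x => f x.weight).prod

variable {x : Segment} {L : List Segment}

theorem weight_pos (hx : 2 ≤ x.area) : 0 < x.weight :=
  Nat.pos_of_mul_pos_right (two_pos.trans_le hx)

theorem bounds_of_weight_pos (hx : 0 < x.weight) :
    x.left ≤ x.excess ∧ x.right ≤ x.excess ∧ x.weight ≤ x.excess + 1 := by
  have length_le : x.left + x.right + 1 ≤ x.area := Nat.le_mul_of_pos_left _ hx
  have weight_le : x.weight ≤ x.area := Nat.le_mul_of_pos_right _ (Nat.succ_pos _)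
  unfold excess
  omega

theorem two_le_area_iff : 2 ≤ x.area ↔ 0 < x.weight ∧ x ≠ ordinary := by
  refine ⟨fun hx => ⟨weight_pos hx, ?_⟩, fun ⟨hw, hx⟩ => ?_⟩
  · rintro rfl
    exact absurd hx (by decide)
  · contrapose! hx
    have := bounds_of_weight_pos hw
    unfold excess at this
    ext <;> simp only [ordinary] <;> omega

theorem area_eq_two_iff :
    x.area = 2 ↔ x ∈ ({⟨0, 0, 2⟩, ⟨1, 0, 1⟩, ⟨0, 1, 1⟩} : Finset Segment) := by
  refine ⟨fun hx => ?_, fun hx => ?_⟩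
  · have excess_eq : x.excess = 1 := congrArg (· - 1) hx
    have hw := weight_pos hx.ge
    have bounds := bounds_of_weight_pos hw
    rw [excess_eq] at bounds
    obtain ⟨l, r, w⟩ := x
    simp only [area] at bounds hx hw
    obtain ⟨hl, hr, hw'⟩ := bounds
    interval_cases l <;> interval_cases r <;> interval_cases w <;> simp_all
  · simp only [Finset.mem_insert, Finset.mem_singleton] at hx
    rcases hx with rfl | rfl | rfl <;> rfl

theorem excess_le_listExcess (hx : x ∈ L) : x.excess ≤ listExcess L :=
  List.single_le_sum (fun _ _ => Nat.zero_le _) _ (List.mem_map_of_mem hx)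

theorem length_le_listExcess (hL : ∀ x ∈ L, 2 ≤ x.area) : L.length ≤ listExcess L := by
  refine (List.length_map excess).symm.trans_le (List.length_le_sum_of_one_le _ ?_)
  simp only [List.mem_map, forall_exists_index, and_imp, forall_apply_eq_imp_iff₂]
  exact fun x hx => Nat.le_sub_of_add_le (hL x hx)

theorem listExcess_eq_one_iff (hL : ∀ x ∈ L, 2 ≤ x.area) :
    listExcess L = 1 ↔ ∃ x, x.area = 2 ∧ L = [x] := by
  constructor
  · intro hL'
    have length_le := length_le_listExcess hL
    rcases L with _ | ⟨x, _ | ⟨y, L⟩⟩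
    · simp [listExcess] at hL'
    · refine ⟨x, ?_, rfl⟩
      simp only [listExcess, List.map_singleton, List.sum_singleton, excess] at hL'
      omega
    · simp [hL'] at length_le
  · rintro ⟨x, hx, rfl⟩
    simp [listExcess, excess, hx]

theorem listExcess_filter (L : List Segment) :
    listExcess (L.filter (· ≠ ordinary)) = listExcess L := by
  rw [listExcess, listExcess, ← sum_map_filter_ne_add_nsmul_count excess ordinary L]
  rfl

theorem cross_ordinary (i g : ℕ) : ordinary.cross i g = if i = g then 1 else 0 := by
  simp only [cross, ordinary, add_zero, le_antisymm_iff, and_comm]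

theorem listCross_filter (L : List Segment) (i g : ℕ) :
    listCross L i g = listCross (L.filter (· ≠ ordinary)) i g +
      if i = g then L.count ordinary else 0 := by
  rw [listCross, listCross, ← sum_map_filter_ne_add_nsmul_count _ ordinary L, cross_ordinary,
    smul_eq_mul, mul_ite, mul_one, mul_zero]

theorem listVal_filter {f : ℕ → ℚ} (hf : f 1 = 1) (L : List Segment) :
    listVal f (L.filter (· ≠ ordinary)) = listVal f L := by
  rw [listVal, listVal, ← prod_map_filter_ne_mul_pow_count _ ordinary L,
    show f ordinary.weight = 1 from hf, one_pow, mul_one]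

end Segment

/-- The lists of non-ordinary segments of total excess at most `δ`. -/
abbrev SegmentFilling (δ : ℕ) : Type :=
  {L : List Segment // (∀ x ∈ L, 2 ≤ x.area) ∧ Segment.listExcess L ≤ δ}

namespace SegmentFilling

open Segment

variable {δ : ℕ}

/-- The filling without segments. -/
def empty (δ : ℕ) : SegmentFilling δ := ⟨[], by simp [listExcess]⟩

theorem bounds (L : SegmentFilling δ) {x : Segment} (hx : x ∈ L.1) :
    x.left ≤ δ ∧ x.right ≤ δ ∧ x.weight ≤ δ + 1 := by
  have bounds := bounds_of_weight_pos (weight_pos (L.2.1 x hx))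
  have excess_le := (excess_le_listExcess hx).trans L.2.2
  omega

instance : Finite (SegmentFilling δ) := by
  let T : Set Segment := (fun p : ℕ × ℕ × ℕ => ⟨p.1, p.2.1, p.2.2⟩) ''
    (Set.Iic δ ×ˢ Set.Iic δ ×ˢ Set.Iic (δ + 1))
  have : Finite T := Set.toFinite T
  refine ((List.finite_length_le T δ).image (List.map Subtype.val)).subset fun L hL => ?_
  have mem_T (x : Segment) (hx : x ∈ L) : x ∈ T :=
    ⟨(x.left, x.right, x.weight), bounds ⟨L, hL⟩ hx, rfl⟩
  refine ⟨L.pmap Subtype.mk mem_T, ?_, ?_⟩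
  · simpa using (length_le_listExcess hL.1).trans hL.2
  · simp [List.map_pmap]

noncomputable instance : Fintype (SegmentFilling δ) := Fintype.ofFinite _

theorem ordinary_notMem (L : SegmentFilling δ) : ordinary ∉ L.1 := fun h =>
  (two_le_area_iff.1 (L.2.1 _ h)).2 rfl

theorem listCross_eq_zero (L : SegmentFilling δ) {i g : ℕ} (h : i + δ < g ∨ g + δ < i) :
    listCross L.1 i g = 0 := by
  refine List.sum_eq_zero fun y hy => ?_
  obtain ⟨x, hx, rfl⟩ := List.mem_map.1 hy
  have bounds := L.bounds hx
  exact if_neg (by omega)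

/-- The total weight with which the filling `F` crosses gap `g`. -/
def crossing (F : ℕ → SegmentFilling δ) (g : ℕ) : ℕ :=
  ∑ i ∈ Finset.range (g + (δ + 1)), listCross (F i).1 i g

open Classical in
/-- The ways to add ordinary segments to the filling `F` in gap `g` so that the gap is crossed with
total weight `g + 1`. There are none if a segment of `F` reaches below gap `0`. -/
def completions (F : ℕ → SegmentFilling δ) (g : ℕ) : Finset (List Segment) :=
  if (∀ x ∈ (F g).1, x.right ≤ g) ∧ crossing F g ≤ g + 1 then
    shuffle ordinary (g + 1 - crossing F g) (F g).1
  else ∅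

theorem mem_completions {F : ℕ → SegmentFilling δ} {g : ℕ} {L : List Segment} :
    L ∈ completions F g ↔ (∀ x ∈ (F g).1, x.right ≤ g) ∧ L.filter (· ≠ ordinary) = (F g).1 ∧
      crossing F g + L.count ordinary = g + 1 := by
  unfold completions
  split_ifs with h
  · rw [mem_shuffle (F g).ordinary_notMem]
    grind
  · grind

theorem crossing_congr {F F' : ℕ → SegmentFilling δ} {g : ℕ}
    (h : ∀ i, g < i + (δ + 1) → i < g + (δ + 1) → F i = F' i) : crossing F g = crossing F' g := by
  refine Finset.sum_congr rfl fun i hi => ?_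
  by_cases hgi : g < i + (δ + 1)
  · rw [h i hgi (Finset.mem_range.1 hi)]
  · rw [listCross_eq_zero _ (by omega), listCross_eq_zero _ (by omega)]

theorem crossing_shift (F : ℕ → SegmentFilling δ) (n : ℕ) :
    crossing (fun i => F (i - n)) (n + (δ + 1)) = crossing F (δ + 1) := by
  rw [crossing, add_assoc, Finset.sum_range_add, Finset.sum_eq_zero, zero_add]
  · refine Finset.sum_congr rfl fun j _ => ?_
    rw [Nat.add_sub_cancel_left]
    refine congrArg List.sum (List.map_congr_left fun x _ => if_congr ?_ rfl rfl)
    omega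
  · intro i hi
    have := Finset.mem_range.1 hi
    exact listCross_eq_zero _ (by omega)

theorem eventuallyPoly_card_completions (F : ℕ → SegmentFilling δ) :
    EventuallyPoly
      (fun n => ((completions (fun i => F (i - n)) (n + (δ + 1))).card : ℚ))
      (F (δ + 1)).1.length ((F (δ + 1)).1.length.factorial : ℚ)⁻¹ := by
  set x := crossing F (δ + 1)
  refine ((EventuallyPoly.choose_sub_add x _).comp_add_right (δ + 2)).congr ?_
  filter_upwards [Filter.eventually_ge_atTop x] with n hn
  have right_le (y : Segment) (hy : y ∈ (F (δ + 1)).1) : y.right ≤ n + (δ + 1) := by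
    have := (F (δ + 1)).bounds hy
    omega
  rw [completions, crossing_shift, Nat.add_sub_cancel_left, if_pos ⟨right_le, by omega⟩,
    card_shuffle (F _).ordinary_notMem]
  rfl

end SegmentFilling

/-- The local model whose fillings are lists of non-ordinary segments. -/
noncomputable def segmentModel (f : ℕ → ℚ) (δ : ℕ) : LocalModel where
  S := SegmentFilling δ
  empty := .empty δ
  range := δ + 1
  size L := L.1.length
  excess L := Segment.listExcess L.1
  lead L := Segment.listVal f L.1 * (L.1.length.factorial : ℚ)⁻¹
  weight F g := Segment.listVal f (F g).1 * (SegmentFilling.completions F g).card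
  topAdm L j := ∀ x ∈ L.1, x.left ≤ j ∧ (x.left = j → x.weight = 1)
  size_empty := rfl
  excess_empty := rfl
  lead_empty := by simp [SegmentFilling.empty, Segment.listVal]
  size_pos L hL := List.length_pos_iff.2 fun h => hL (Subtype.ext h)
  size_le_excess L := Segment.length_le_listExcess L.2.1
  weight_congr {F F' g} h := by
    rw [SegmentFilling.completions, SegmentFilling.completions, SegmentFilling.crossing_congr h,
      h g (by omega) (by omega)]
  weight_empty g := by
    simp [SegmentFilling.empty, Segment.listVal, SegmentFilling.completions,
      SegmentFilling.crossing, Segment.listCross, card_shuffle]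
  eventuallyPoly_weight F := by
    simp only [Nat.add_sub_cancel_left]
    exact (SegmentFilling.eventuallyPoly_card_completions F).const_mul _
  topAdm_far L i h x hx := by
    have bounds := L.bounds hx
    omega
  topAdm_empty _ _ hx := absurd hx List.not_mem_nil

theorem unitCount_segmentModel {f : ℕ → ℚ} (hf : f 1 = 1) {δ : ℕ} (hδ : 1 ≤ δ) :
    (segmentModel f δ).unitCount = f 2 + 2 := by
  have singleton_mem (x : Segment) (hx : x.area = 2) :
      (∀ y ∈ [x], 2 ≤ y.area) ∧ Segment.listExcess [x] ≤ δ := by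
    simpa [Segment.listExcess, Segment.excess, hx] using hδ
  have sum_singletons : ∑ x ∈ ({⟨0, 0, 2⟩, ⟨1, 0, 1⟩, ⟨0, 1, 1⟩} : Finset Segment), f x.weight =
      (segmentModel f δ).unitCount := by
    refine Finset.sum_bij
      (fun x hx => ⟨[x], singleton_mem x (Segment.area_eq_two_iff.2 hx)⟩) ?_ ?_ ?_ ?_
    · exact fun x hx => Finset.mem_filter.2 ⟨Finset.mem_univ _, (Segment.listExcess_eq_one_iff
        (singleton_mem x (Segment.area_eq_two_iff.2 hx)).1).2
          ⟨x, Segment.area_eq_two_iff.2 hx, rfl⟩⟩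
    · exact fun x _ y _ h => List.singleton_inj.1 (congrArg Subtype.val h)
    · intro L hL
      obtain ⟨x, hx, hLx⟩ := (Segment.listExcess_eq_one_iff L.2.1).1 (Finset.mem_filter.1 hL).2
      exact ⟨x, Segment.area_eq_two_iff.1 hx, Subtype.ext hLx.symm⟩
    · intro x _
      simp [segmentModel, Segment.listVal]
  rw [← sum_singletons, Finset.sum_insert (by simp), Finset.sum_insert (by simp),
    Finset.sum_singleton, hf]
  norm_num

/-- The families of segments in `d` gaps that encode marked floor diagrams of degree `d` and
cogenus `δ`. -/
structure IsConfig (d δ : ℕ) (ω : Fin d → List Segment) : Prop where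
  segment : ∀ i : Fin d, ∀ x ∈ ω i, 0 < x.weight ∧ x.right ≤ i ∧ x.left ≤ d - 1 - i ∧
    (x.left = d - 1 - i → x.weight = 1)
  cross : ∀ g : Fin d, ∑ i : Fin d, Segment.listCross (ω i) i g = g + 1
  excess : ∑ i, Segment.listExcess (ω i) = δ

section Configs

open Segment SegmentFilling

variable {d δ : ℕ}

/-- The segments in `d` gaps given by `M`, with no segments in the remaining gaps. -/
def extendFillings (M : Fin d → SegmentFilling δ) : ℕ → SegmentFilling δ :=
  seqAppend M fun _ => .empty δ

theorem extendFillings_val (M : Fin d → SegmentFilling δ) (i : Fin d) :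
    extendFillings M i = M i :=
  seqAppend_lt M _ i

theorem crossing_extendFillings (M : Fin d → SegmentFilling δ) (g : ℕ) :
    crossing (extendFillings M) g = ∑ i : Fin d, listCross (M i).1 i g := by
  simp only [← extendFillings_val M]
  rw [Fin.sum_univ_eq_sum_range fun i => listCross (extendFillings M i).1 i g]
  refine Finset.sum_congr_of_eq_on_inter (fun i _ hi => ?_) (fun i _ hi => ?_) fun _ _ _ => rfl
  · rw [extendFillings, seqAppend_ge M _ (by simpa using hi)]
    rfl
  · rw [Finset.mem_range] at hi
    exact listCross_eq_zero _ (by omega)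

open Classical in
/-- The families of non-ordinary segments in `d` gaps that have total excess `δ` and respect the
upper end. -/
noncomputable def admissibleFillings (d δ : ℕ) : Finset (Fin d → SegmentFilling δ) :=
  {M | (∑ i, listExcess (M i).1 = δ) ∧
    ∀ i : Fin d, ∀ x ∈ (M i).1, x.left ≤ d - 1 - i ∧ (x.left = d - 1 - i → x.weight = 1)}

/-- The ways to add ordinary segments to `M` so that every gap `g` is crossed with total weight
`g + 1`. -/
def fillingCompletions (M : Fin d → SegmentFilling δ) : Finset (Fin d → List Segment) :=
  Fintype.piFinset fun g : Fin d => completions (extendFillings M) g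

theorem mem_fillingCompletions {M : Fin d → SegmentFilling δ} {ω : Fin d → List Segment} :
    ω ∈ fillingCompletions M ↔ (∀ g : Fin d, ∀ x ∈ (M g).1, x.right ≤ g) ∧
      (∀ g, (ω g).filter (· ≠ ordinary) = (M g).1) ∧
      ∀ g : Fin d, ∑ i : Fin d, listCross (ω i) i g = g + 1 := by
  simp only [fillingCompletions, Fintype.mem_piFinset, mem_completions, extendFillings_val,
    crossing_extendFillings, forall_and]
  refine and_congr_right fun _ => and_congr_right fun filter_eq => forall_congr' fun g => ?_
  simp only [listCross_filter (ω _), filter_eq, Finset.sum_add_distrib, Fin.val_inj,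
    Finset.sum_ite_eq', Finset.mem_univ, if_true]

/-- The finite set of all families that satisfy `IsConfig d δ`. -/
noncomputable def configs (d δ : ℕ) : Finset (Fin d → List Segment) :=
  (admissibleFillings d δ).biUnion fillingCompletions

theorem isConfig_of_mem_fillingCompletions {M : Fin d → SegmentFilling δ}
    (hM : M ∈ admissibleFillings d δ) {ω : Fin d → List Segment} (hω : ω ∈ fillingCompletions M) :
    IsConfig d δ ω := by
  obtain ⟨excess_eq, left_le⟩ := (Finset.mem_filter.1 hM).2
  obtain ⟨right_le, filter_eq, cross_eq⟩ := mem_fillingCompletions.1 hω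
  refine ⟨fun i x hx => ?_, cross_eq, ?_⟩
  · by_cases hxo : x = ordinary
    · subst hxo
      simp [ordinary]
    · have hxM : x ∈ (M i).1 := by
        rw [← filter_eq]
        exact List.mem_filter.2 ⟨hx, decide_eq_true hxo⟩
      exact ⟨weight_pos ((M i).2.1 x hxM), right_le i x hxM, left_le i x hxM⟩
  · simpa only [← filter_eq, listExcess_filter] using excess_eq

theorem IsConfig.exists_filling {ω : Fin d → List Segment} (hω : IsConfig d δ ω) :
    ∃ M ∈ admissibleFillings d δ, ω ∈ fillingCompletions M := by
  have filter_mem (i : Fin d) : (∀ x ∈ (ω i).filter (· ≠ ordinary), 2 ≤ x.area) ∧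
      listExcess ((ω i).filter (· ≠ ordinary)) ≤ δ := by
    refine ⟨fun x hx => ?_, ?_⟩
    · obtain ⟨hx, hxo⟩ := List.mem_filter.1 hx
      exact two_le_area_iff.2 ⟨(hω.segment i x hx).1, of_decide_eq_true hxo⟩
    · rw [listExcess_filter, ← hω.excess]
      exact Finset.single_le_sum (f := fun i => listExcess (ω i))
        (fun _ _ => Nat.zero_le _) (Finset.mem_univ i)
  refine ⟨fun i => ⟨_, filter_mem i⟩, Finset.mem_filter.2 ⟨Finset.mem_univ _, ?_, ?_⟩,
    mem_fillingCompletions.2 ⟨?_, fun _ => rfl, hω.cross⟩⟩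
  · simpa only [listExcess_filter] using hω.excess
  · exact fun i x hx => (hω.segment i x (List.mem_of_mem_filter hx)).2.2
  · exact fun i x hx => (hω.segment i x (List.mem_of_mem_filter hx)).2.1

theorem mem_configs {ω : Fin d → List Segment} : ω ∈ configs d δ ↔ IsConfig d δ ω := by
  rw [configs, Finset.mem_biUnion]
  exact ⟨fun ⟨_, hM, hω⟩ => isConfig_of_mem_fillingCompletions hM hω, IsConfig.exists_filling⟩

theorem sum_fillingCompletions {f : ℕ → ℚ} (hf : f 1 = 1) (M : Fin d → SegmentFilling δ) :
    ∑ ω ∈ fillingCompletions M, ∏ i, listVal f (ω i) =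
      ∏ g ∈ Finset.range d, (segmentModel f δ).weight (extendFillings M) g := by
  have listVal_eq (ω) (hω : ω ∈ fillingCompletions M) :
      ∏ i, listVal f (ω i) = ∏ i, listVal f (M i).1 :=
    Finset.prod_congr rfl fun i _ => by
      rw [← listVal_filter hf, (mem_fillingCompletions.1 hω).2.1]
  rw [Finset.sum_congr rfl listVal_eq, Finset.sum_const, nsmul_eq_mul, fillingCompletions,
    Fintype.card_piFinset, Nat.cast_prod, ← Finset.prod_mul_distrib, ← Fin.prod_univ_eq_prod_range]
  refine Finset.prod_congr rfl fun g _ => ?_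
  rw [← extendFillings_val M g, mul_comm]
  rfl

theorem sum_configs {f : ℕ → ℚ} (hf : f 1 = 1) (d δ : ℕ) :
    ∑ ω ∈ configs d δ, ∏ i, listVal f (ω i) = (segmentModel f δ).count d δ := by
  rw [configs, Finset.sum_biUnion]
  · refine Finset.sum_congr (Finset.ext fun M => ?_) fun M _ => sum_fillingCompletions hf M
    exact (Finset.mem_filter_univ M).trans (LocalModel.mem_fillings (𝓜 := segmentModel f δ)).symm
  · refine fun M _ M' _ hne => Finset.disjoint_left.2 fun ω hω hω' => hne (funext fun i => ?_)
    exact Subtype.ext <|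
      ((mem_fillingCompletions.1 hω).2.1 i).symm.trans ((mem_fillingCompletions.1 hω').2.1 i)

theorem eventuallyPoly_sum_configs {f : ℕ → ℚ} (hf : f 1 = 1) (δ : ℕ) :
    EventuallyPoly (fun d => ∑ ω ∈ configs d δ, ∏ i, listVal f (ω i)) (2 * δ)
      (((f 2 + 2) / 2) ^ δ / δ.factorial) := by
  have leadCoeff_eq : (segmentModel f δ).leadCoeff δ = ((f 2 + 2) / 2) ^ δ / δ.factorial := by
    rcases δ.eq_zero_or_pos with rfl | hδ
    · simp only [LocalModel.leadCoeff, pow_zero]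
    · rw [LocalModel.leadCoeff, unitCount_segmentModel hf hδ]
  rw [← leadCoeff_eq]
  simp only [sum_configs hf]
  exact (segmentModel f δ).eventuallyPoly_count δ

end Configs

/-! ### Markings as words -/

section Interleave

variable {α β : Type*}

/-- The list that has the elements of `l` in order, each `a` preceded by the block `W a`. -/
def interleave (l : List α) (W : α → List β) : List (α ⊕ β) :=
  l.flatMap fun a => (W a).map Sum.inr ++ [Sum.inl a]

theorem interleave_cons (a : α) (l : List α) (W : α → List β) :
    interleave (a :: l) W = (W a).map Sum.inr ++ Sum.inl a :: interleave l W := by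
  simp [interleave]

theorem interleave_congr {l : List α} {W W' : α → List β} (h : ∀ a ∈ l, W a = W' a) :
    interleave l W = interleave l W' :=
  List.flatMap_congr fun a ha => by rw [h a ha]

theorem map_inr_append_inl_cons_inj {a : α} {R R' : List (α ⊕ β)} :
    ∀ {A A' : List β}, A.map Sum.inr ++ Sum.inl a :: R = A'.map Sum.inr ++ Sum.inl a :: R' →
      A = A' ∧ R = R'
  | [], [], h => ⟨rfl, (List.cons.inj h).2⟩
  | [], _ :: _, h => absurd (List.cons.inj h).1 (by simp)
  | _ :: _, [], h => absurd (List.cons.inj h).1 (by simp)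
  | x :: A, y :: A', h => by
    obtain ⟨hhead, htail⟩ := List.cons.inj h
    obtain ⟨rfl, rfl⟩ := map_inr_append_inl_cons_inj htail
    exact ⟨by rw [Sum.inr.inj hhead], rfl⟩

theorem eq_of_interleave_eq {W W' : α → List β} :
    ∀ {l : List α}, interleave l W = interleave l W' → ∀ a ∈ l, W a = W' a
  | [], _ => by simp
  | a :: l, h => by
    rw [interleave_cons, interleave_cons] at h
    obtain ⟨hhead, htail⟩ := map_inr_append_inl_cons_inj h
    exact List.forall_mem_cons.2 ⟨hhead, eq_of_interleave_eq htail⟩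

theorem exists_interleave_append_eq :
    ∀ L : List (α ⊕ β), (L.filterMap Sum.getLeft?).Nodup →
      ∃ (W : α → List β) (t : List β),
        interleave (L.filterMap Sum.getLeft?) W ++ t.map Sum.inr = L
  | [], _ => ⟨fun _ => [], [], rfl⟩
  | Sum.inl a :: L, h => by
    classical
    rw [List.filterMap_cons_some (f := Sum.getLeft?) (a := Sum.inl a) rfl] at h ⊢
    obtain ⟨ha, hL⟩ := List.nodup_cons.1 h
    obtain ⟨W, t, hW⟩ := exists_interleave_append_eq L hL
    refine ⟨Function.update W a [], t, ?_⟩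
    rw [interleave_cons, Function.update_self, interleave_congr (W' := W) fun k hk =>
      Function.update_of_ne (ne_of_mem_of_not_mem hk ha) _ _]
    exact congrArg (Sum.inl a :: ·) hW
  | Sum.inr b :: L, h => by
    classical
    rw [List.filterMap_cons_none rfl] at h ⊢
    obtain ⟨W, t, hW⟩ := exists_interleave_append_eq L h
    rcases hl : L.filterMap Sum.getLeft? with _ | ⟨a, l⟩ <;> rw [hl] at hW h
    · exact ⟨W, b :: t, congrArg (Sum.inr b :: ·) hW⟩
    · refine ⟨Function.update W a (b :: W a), t, ?_⟩
      rw [interleave_cons] at hW ⊢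
      rw [Function.update_self, interleave_congr (W' := W) fun k hk =>
        Function.update_of_ne (ne_of_mem_of_not_mem hk (List.nodup_cons.1 h).1) _ _]
      exact congrArg (Sum.inr b :: ·) hW

end Interleave

section Enumeration

variable {α β γ : Type*}

theorem exists_ofFn_eq {n : ℕ} {l : List α} (h : l.length = n) :
    ∃ g : Fin n → α, List.ofFn g = l := by
  subst h
  exact ⟨l.get, List.ofFn_get l⟩

theorem exists_map_univ_eq {n : ℕ} {s : Multiset α} (h : s.card = n) :
    ∃ g : Fin n → α, Finset.univ.val.map g = s := by
  induction s using Quotient.inductionOn with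
  | h l =>
    obtain ⟨g, rfl⟩ := exists_ofFn_eq (l := l) h
    exact ⟨g, Fin.univ_val_map g⟩

theorem exists_equiv_of_map_univ_eq [Fintype α] [Fintype β] {f : α → γ} {g : β → γ}
    (h : Finset.univ.val.map f = Finset.univ.val.map g) : ∃ e : α ≃ β, ∀ a, g (e a) = f a := by
  classical
  have card_fiber : ∀ c, Fintype.card {a // f a = c} = Fintype.card {b // g b = c} := fun c => by
    have count_eq := congrArg (Multiset.count c) h
    rw [Multiset.count_map, Multiset.count_map] at count_eq
    rw [Fintype.card_subtype, Fintype.card_subtype, Finset.card_def, Finset.card_def,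
      Finset.filter_val, Finset.filter_val]
    simpa only [eq_comm] using count_eq
  let F : ∀ c, {a // f a = c} ≃ {b // g b = c} := fun c => Fintype.equivOfCardEq (card_fiber c)
  exact ⟨Equiv.ofFiberEquiv F, Equiv.ofFiberEquiv_map F⟩

theorem exists_equiv_ofFn_eq [Fintype α] {f : α → γ} {L : List γ}
    (h : Finset.univ.val.map f = (L : Multiset γ)) :
    ∃ e : α ≃ Fin (Fintype.card α), List.ofFn (f ∘ e.symm) = L := by
  have hlen : L.length = Fintype.card α := by
    rw [← Multiset.coe_card, ← h, Multiset.card_map]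
    rfl
  obtain ⟨g, rfl⟩ := exists_ofFn_eq hlen
  rw [← Fin.univ_val_map] at h
  obtain ⟨e, he⟩ := exists_equiv_of_map_univ_eq h
  refine ⟨e, congrArg List.ofFn (funext fun p => ?_)⟩
  rw [Function.comp_apply, ← he, Equiv.apply_symm_apply]

end Enumeration

namespace FloorDiagram

variable {d : ℕ}

/-- The label of a black vertex: the edge on which it lies, or the white vertex at which the added
edge starting at it ends. -/
abbrev Black (d : ℕ) : Type := WEdge d ⊕ Fin d

/-- The label of a vertex of a marking: a white vertex or the label of a black one. -/
abbrev Letter (d : ℕ) : Type := Fin d ⊕ Black d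

/-- Whether vertices with the given labels may occur in the given order in a marking. -/
def Before : Letter d → Letter d → Prop
  | Sum.inl v, Sum.inl w => v < w
  | Sum.inl v, Sum.inr (Sum.inl e) => v < e.tgt
  | Sum.inl v, Sum.inr (Sum.inr t) => v < t
  | Sum.inr (Sum.inl e), Sum.inl v => e.src < v
  | Sum.inr (Sum.inr _), Sum.inl _ => True
  | Sum.inr _, Sum.inr _ => True

/-- Whether a black vertex may be placed between the white vertices `k - 1` and `k`. -/
def Fits (k : Fin d) : Black d → Prop
  | Sum.inl e => e.src < k ∧ k ≤ e.tgt
  | Sum.inr t => k ≤ t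

/-- The weight of the edge of a marking between vertices with the given labels, or `0`. -/
noncomputable def letterAdj : Letter d → Letter d → ℕ
  | Sum.inl v, Sum.inr (Sum.inl e) => if e.src = v then e.wt else 0
  | Sum.inr (Sum.inl e), Sum.inl v => if e.tgt = v then e.wt else 0
  | Sum.inr (Sum.inr t), Sum.inl v => if t = v then 1 else 0
  | _, _ => 0

theorem before_inr_inr (b b' : Black d) : Before (Sum.inr b) (Sum.inr b') := by
  cases b <;> trivial

theorem fits_iff_before {k : Fin d} {b : Black d} :
    Fits k b ↔ Before (Sum.inr b) (Sum.inl k) ∧ ∀ j < k, Before (Sum.inl j) (Sum.inr b) := by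
  rcases b with e | t
  · exact and_congr_right' forall_lt_iff_le.symm
  · exact forall_lt_iff_le.symm.trans (true_and _).symm.to_iff

theorem Before.trans_le {b : Black d} {k j : Fin d} (hb : Before (Sum.inr b) (Sum.inl k))
    (hkj : k ≤ j) : Before (Sum.inr b) (Sum.inl j) := by
  rcases b with e | t
  · exact lt_of_lt_of_le hb hkj
  · trivial

theorem exists_not_before (b : Black d) : ∃ v, ¬ Before (Sum.inl v) (Sum.inr b) := by
  rcases b with e | t
  · exact ⟨e.tgt, lt_irrefl e.tgt⟩
  · exact ⟨t, lt_irrefl t⟩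

theorem black_ext {b b' : Black d} (hb : ∀ e, b = Sum.inl e → 1 ≤ e.wt)
    (hb' : ∀ e, b' = Sum.inl e → 1 ≤ e.wt)
    (hfrom : ∀ v, letterAdj (Sum.inl v) (Sum.inr b) = letterAdj (Sum.inl v) (Sum.inr b'))
    (hto : ∀ v, letterAdj (Sum.inr b) (Sum.inl v) = letterAdj (Sum.inr b') (Sum.inl v)) :
    b = b' := by
  rcases b with e | t <;> rcases b' with e' | t'
  · have hpos := hb e rfl
    have hsrc := hfrom e.src
    have htgt := hto e.tgt
    simp only [letterAdj, if_true] at hsrc htgt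
    exact congrArg Sum.inl (WEdge.ext (by grind) (by grind) (by grind))
  · have hsrc := hfrom e.src
    have hpos := hb e rfl
    simp only [letterAdj, if_true] at hsrc
    omega
  · have hsrc := hfrom e'.src
    have hpos := hb' e' rfl
    simp only [letterAdj, if_true] at hsrc
    omega
  · have htgt := hto t
    simp only [letterAdj, if_true] at htgt
    exact congrArg Sum.inr (by grind)

/-- The label of a vertex of `D`, where `t` gives the ends of the added edges. -/
def label (D : FloorDiagram d) (t : Fin d → Fin d) : D.MVertex → Letter d :=
  Sum.map id (Sum.map (fun e => e.1) t)

theorem map_label (D : FloorDiagram d) (t : Fin d → Fin d) :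
    Finset.univ.val.map (D.label t) = Finset.univ.val.map Sum.inl +
      (D.edges.map Sum.inl + (Finset.univ.val.map t).map Sum.inr).map Sum.inr := by
  have univ_val : (Finset.univ : Finset D.MVertex).val = Finset.univ.val.map Sum.inl +
      (Finset.univ.val.map Sum.inl + Finset.univ.val.map Sum.inr).map Sum.inr := rfl
  simp only [univ_val, Multiset.map_add, Multiset.map_map]
  congr 2
  exact Multiset.map_univ D.edges (fun e => (Sum.inr (Sum.inl e) : Letter d))

namespace Marking

variable {D : FloorDiagram d}

/-- The labels of the vertices of a marking, in their total order. -/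
def word (M : D.Marking) (p : Fin (Fintype.card D.MVertex)) : Letter d :=
  D.label M.target (M.pos.symm p)

theorem word_pos (M : D.Marking) (x : D.MVertex) : M.word (M.pos x) = D.label M.target x := by
  rw [word, Equiv.symm_apply_apply]

theorem adj_eq (M : D.Marking) (x y : D.MVertex) :
    M.adj x y = letterAdj (D.label M.target x) (D.label M.target y) := by
  rcases x with v | e | i <;> rcases y with w | e' | j <;> rfl

theorem label_eq_of_adj_eq {M M' : D.Marking} {σ : D.MVertex ≃ D.MVertex}
    (hwhite : ∀ v : Fin d, σ (Sum.inl v) = Sum.inl v)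
    (hadj : ∀ x y, M'.adj (σ x) (σ y) = M.adj x y) (x : D.MVertex) :
    D.label M'.target (σ x) = D.label M.target x := by
  have wt_pos : ∀ (t : Fin d → Fin d) (y : D.edges ⊕ Fin d) (e : WEdge d),
      Sum.map (fun e => e.1) t y = Sum.inl e → 1 ≤ e.wt := by
    rintro t (e | i) _ ⟨⟩
    exact D.wt_pos e.1 Multiset.coe_mem
  rcases x with v | y
  · rw [hwhite]
    rfl
  · rcases hσ : σ (Sum.inr y) with v | z
    · rw [← hwhite v] at hσ
      exact absurd (σ.injective hσ) (by simp)
    · refine congrArg Sum.inr (black_ext (wt_pos _ z) (wt_pos _ y) (fun v => ?_) fun v => ?_)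
      · have h := hadj (Sum.inl v) (Sum.inr y)
        rwa [hwhite, hσ, adj_eq, adj_eq] at h
      · have h := hadj (Sum.inr y) (Sum.inl v)
        rwa [hwhite, hσ, adj_eq, adj_eq] at h

theorem pos_eq_of_pos_lt_iff {M M' : D.Marking} {σ : D.MVertex ≃ D.MVertex}
    (hpos : ∀ x y, M'.pos (σ x) < M'.pos (σ y) ↔ M.pos x < M.pos y) (x : D.MVertex) :
    M'.pos (σ x) = M.pos x := by
  let τ : Fin (Fintype.card D.MVertex) ≃ Fin (Fintype.card D.MVertex) :=
    M.pos.symm.trans (σ.trans M'.pos)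
  have hτ : StrictMono τ := fun p q hpq => (hpos _ _).2 (by simpa using hpq)
  have τ_eq := DFunLike.congr_fun (Subsingleton.elim
    (hτ.orderIsoOfSurjective τ τ.surjective) (OrderIso.refl _)) (M.pos x)
  simpa [τ] using τ_eq

theorem equiv_of_word_eq {M M' : D.Marking} (h : M.word = M'.word) : M ≈ M' := by
  let σ : D.MVertex ≃ D.MVertex := M.pos.trans M'.pos.symm
  have hlabel : ∀ x, D.label M'.target (σ x) = D.label M.target x := fun x => by
    rw [← word_pos, ← word_pos, h]
    simp [σ]
  refine ⟨σ, fun v => ?_, fun x y => by rw [adj_eq, adj_eq, hlabel, hlabel], fun x y => by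
    simp [σ]⟩
  have hv := hlabel (Sum.inl v)
  rcases hσ : σ (Sum.inl v) with w | y <;> rw [hσ] at hv
  · exact congrArg Sum.inl (Sum.inl.inj hv)
  · exact absurd hv (by simp [label])

theorem equiv_iff {M M' : D.Marking} : M ≈ M' ↔ M.word = M'.word := by
  refine ⟨?_, equiv_of_word_eq⟩
  rintro ⟨σ, hwhite, hadj, hpos⟩
  funext p
  obtain ⟨x, rfl⟩ := M.pos.surjective p
  rw [word_pos, ← label_eq_of_adj_eq hwhite hadj x, ← pos_eq_of_pos_lt_iff hpos x, word_pos]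

theorem pos_inl_strictMono (M : D.Marking) : StrictMono fun v : Fin d => M.pos (Sum.inl v) :=
  M.white_lt

theorem before_word (M : D.Marking) {p q : Fin (Fintype.card D.MVertex)} (hpq : p < q) :
    Before (M.word p) (M.word q) := by
  obtain ⟨x, rfl⟩ := M.pos.surjective p
  obtain ⟨y, rfl⟩ := M.pos.surjective q
  rw [word_pos, word_pos]
  have white_lt_iff := fun {v w} => M.pos_inl_strictMono.lt_iff_lt (a := v) (b := w)
  rcases x with v | e | i <;> rcases y with w | e' | j
  · exact white_lt_iff.1 hpq
  · exact white_lt_iff.1 (hpq.trans (M.lt_tgt e'))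
  · exact white_lt_iff.1 (hpq.trans (M.end_lt j))
  · exact white_lt_iff.1 ((M.src_lt e).trans hpq)
  all_goals trivial

theorem coe_ofFn_word (M : D.Marking) :
    (List.ofFn M.word : Multiset (Letter d)) = Finset.univ.val.map (D.label M.target) := by
  have hword : M.word = D.label M.target ∘ M.pos.symm := rfl
  rw [← Fin.univ_val_map, hword, ← Multiset.map_map, Multiset.map_univ_val_equiv]

end Marking

/-- The edges on which the given black vertices lie. -/
def edgesOf (B : Multiset (Black d)) : Multiset (WEdge d) := B.filterMap Sum.getLeft?

/-- The ends of the added edges that start at the given black vertices. -/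
def endsOf (B : Multiset (Black d)) : Multiset (Fin d) := B.filterMap Sum.getRight?

theorem edgesOf_cons_inl (e : WEdge d) (B : Multiset (Black d)) :
    edgesOf (Sum.inl e ::ₘ B) = e ::ₘ edgesOf B :=
  Multiset.filterMap_cons_some Sum.getLeft? _ _ rfl

theorem edgesOf_cons_inr (t : Fin d) (B : Multiset (Black d)) :
    edgesOf (Sum.inr t ::ₘ B) = edgesOf B :=
  Multiset.filterMap_cons_none _ _ rfl

theorem endsOf_cons_inl (e : WEdge d) (B : Multiset (Black d)) :
    endsOf (Sum.inl e ::ₘ B) = endsOf B :=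
  Multiset.filterMap_cons_none _ _ rfl

theorem endsOf_cons_inr (t : Fin d) (B : Multiset (Black d)) :
    endsOf (Sum.inr t ::ₘ B) = t ::ₘ endsOf B :=
  Multiset.filterMap_cons_some Sum.getRight? _ _ rfl

theorem map_edgesOf_add_map_endsOf (B : Multiset (Black d)) :
    (edgesOf B).map Sum.inl + (endsOf B).map Sum.inr = B := by
  induction B using Multiset.induction_on with
  | empty => rfl
  | cons b B ih =>
    rcases b with e | t
    · rw [edgesOf_cons_inl, endsOf_cons_inl, Multiset.map_cons, Multiset.cons_add, ih]
    · rw [edgesOf_cons_inr, endsOf_cons_inr, Multiset.map_cons, Multiset.add_cons, ih]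

theorem filterMap_const_none {α β : Type*} (s : Multiset α) :
    s.filterMap (fun _ => (none : Option β)) = 0 :=
  Multiset.eq_zero_of_forall_notMem (by simp)

theorem edgesOf_map_add_map (E : Multiset (WEdge d)) (T : Multiset (Fin d)) :
    edgesOf (E.map Sum.inl + T.map Sum.inr) = E := by
  simp [edgesOf, Multiset.filterMap_add, Multiset.filterMap_map, Function.comp_def,
    filterMap_const_none]

theorem endsOf_map_add_map (E : Multiset (WEdge d)) (T : Multiset (Fin d)) :
    endsOf (E.map Sum.inl + T.map Sum.inr) = T := by
  simp [endsOf, Multiset.filterMap_add, Multiset.filterMap_map, Function.comp_def,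
    filterMap_const_none]

/-- The multiset of all black vertices of a word. -/
def blacks (W : Fin d → List (Black d)) : Multiset (Black d) := ∑ k, (W k : Multiset (Black d))

/-- The list of all vertices, where `W k` lists the black vertices between the white vertices
`k - 1` and `k`. -/
def wordList (W : Fin d → List (Black d)) : List (Letter d) := interleave (List.finRange d) W

/-- The words that encode markings of a floor diagram. -/
structure IsWord (D : FloorDiagram d) (W : Fin d → List (Black d)) : Prop where
  fits : ∀ k, ∀ b ∈ W k, Fits k b
  edges_eq : edgesOf (blacks W) = D.edges
  div_eq : ∀ v, edgeDiv D.edges v + (endsOf (blacks W)).count v = 1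

theorem wordList_injective : Function.Injective (wordList (d := d)) := fun _ _ h =>
  funext fun k => eq_of_interleave_eq h k (List.mem_finRange k)

theorem coe_wordList (W : Fin d → List (Black d)) :
    (wordList W : Multiset (Letter d)) =
      Finset.univ.val.map Sum.inl + (blacks W).map Sum.inr := by
  have wordList_eq_bind : (wordList W : Multiset (Letter d)) =
      (Finset.univ : Finset (Fin d)).val.bind
        fun k => ((W k : Multiset (Black d)).map Sum.inr + {Sum.inl k}) := by
    rw [wordList, interleave, ← Multiset.coe_bind]
    rfl
  rw [wordList_eq_bind, Multiset.bind_add, Multiset.bind_singleton, add_comm, blacks]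
  congr 1
  exact (map_sum (Multiset.mapAddMonoidHom (Sum.inr : Black d → Letter d))
    (fun k => (W k : Multiset (Black d))) Finset.univ).symm

theorem pairwise_finRange_iff {R : Fin d → Fin d → Prop} :
    (List.finRange d).Pairwise R ↔ ∀ i j, i < j → R i j := by
  rw [← List.ofFn_id, List.pairwise_ofFn]
  rfl

theorem pairwise_before_wordList (W : Fin d → List (Black d)) :
    (wordList W).Pairwise Before ↔ ∀ k, ∀ b ∈ W k, Fits k b := by
  rw [wordList, interleave, List.pairwise_flatMap, pairwise_finRange_iff]
  refine ⟨fun ⟨hblock, hblocks⟩ k b hb => fits_iff_before.2 ⟨?_, fun j hj => ?_⟩, fun h => ⟨?_, ?_⟩⟩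
  · exact (List.pairwise_append.1 (hblock k (List.mem_finRange k))).2.2 _
      (List.mem_map_of_mem hb) _ (List.mem_singleton_self _)
  · exact hblocks j k hj _ (by simp) _ (by simp [hb])
  · refine fun k _ => List.pairwise_append.2 ⟨List.pairwise_map.2
      (List.pairwise_of_forall before_inr_inr), List.pairwise_singleton _ _, ?_⟩
    simp only [List.mem_map, List.mem_singleton, forall_eq, forall_exists_index, and_imp,
      forall_apply_eq_imp_iff₂]
    exact fun b hb => (fits_iff_before.1 (h k b hb)).1
  · intro i j hij
    simp only [List.mem_append, List.mem_map, List.mem_singleton]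
    rintro _ (⟨b, hb, rfl⟩ | rfl) _ (⟨b', hb', rfl⟩ | rfl)
    · exact before_inr_inr b b'
    · exact (fits_iff_before.1 (h i b hb)).1.trans_le hij.le
    · exact (fits_iff_before.1 (h j b' hb')).2 i hij
    · exact hij

theorem exists_wordList_eq {L : List (Letter d)} (hL : L.Pairwise Before)
    (hwhite : ∀ v, Sum.inl v ∈ L) : ∃ W, wordList W = L := by
  have whites_eq : L.filterMap Sum.getLeft? = List.finRange d := by
    refine List.Pairwise.eq_of_mem_iff (r := (· < ·)) ?_ (List.pairwise_lt_finRange d) fun v => ?_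
    · rw [List.pairwise_filterMap]
      refine hL.imp ?_
      rintro (v | b) (w | b') h _ ⟨⟩ _ ⟨⟩
      exact h
    · exact iff_of_true (List.mem_filterMap.2 ⟨_, hwhite v, rfl⟩) (List.mem_finRange v)
  obtain ⟨W, t, hW⟩ := exists_interleave_append_eq L (whites_eq ▸ List.nodup_finRange d)
  rw [whites_eq] at hW
  rw [← hW] at hL
  have ht : t = [] := by
    refine List.eq_nil_iff_forall_not_mem.2 fun b hb => ?_
    obtain ⟨v, hv⟩ := exists_not_before b
    refine hv ((List.pairwise_append.1 hL).2.2 _ ?_ _ (List.mem_map_of_mem hb))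
    exact List.mem_flatMap.2 ⟨v, List.mem_finRange v, by simp⟩
  exact ⟨W, by rw [← hW, ht, List.map_nil, List.append_nil, wordList]⟩

theorem count_map_univ (t : Fin d → Fin d) (v : Fin d) :
    (Finset.univ.val.map t).count v = (Finset.univ.filter fun i => t i = v).card := by
  rw [Multiset.count_map, Finset.card_def, Finset.filter_val]
  simp only [eq_comm]

theorem Marking.exists_word {D : FloorDiagram d} (M : D.Marking) :
    ∃ W, IsWord D W ∧ wordList W = List.ofFn M.word := by
  have hpairwise : (List.ofFn M.word).Pairwise Before :=
    List.pairwise_ofFn.2 fun _ _ hpq => M.before_word hpq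
  obtain ⟨W, hW⟩ := exists_wordList_eq hpairwise fun v => by
    rw [← Multiset.mem_coe, M.coe_ofFn_word]
    exact Multiset.mem_map.2 ⟨Sum.inl v, Finset.mem_univ _, rfl⟩
  have hblacks : blacks W = D.edges.map Sum.inl + (Finset.univ.val.map M.target).map Sum.inr := by
    have hcoe := congrArg (fun L : List (Letter d) => (L : Multiset (Letter d))) hW
    rw [coe_wordList, M.coe_ofFn_word, map_label] at hcoe
    exact Multiset.map_injective Sum.inr_injective (add_left_cancel hcoe)
  refine ⟨W, ⟨(pairwise_before_wordList W).1 (hW ▸ hpairwise), ?_, fun v => ?_⟩, hW⟩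
  · rw [hblacks, edgesOf_map_add_map]
  · rw [hblacks, endsOf_map_add_map, count_map_univ]
    exact M.div_eq v

theorem edgeDiv_cons (e : WEdge d) (E : Multiset (WEdge d)) (v : Fin d) :
    edgeDiv (e ::ₘ E) v = edgeDiv E v +
      ((if e.tgt = v then (e.wt : ℤ) else 0) - if e.src = v then (e.wt : ℤ) else 0) := by
  simp only [edgeDiv, Multiset.map_cons, Multiset.sum_cons]
  ring

theorem sum_edgeDiv (E : Multiset (WEdge d)) : ∑ v, edgeDiv E v = 0 := by
  induction E using Multiset.induction_on with
  | empty => simp [edgeDiv]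
  | cons e E ih => simp [edgeDiv_cons, Finset.sum_add_distrib, ih]

theorem card_eq_of_edgeDiv_add_count {E : Multiset (WEdge d)} {T : Multiset (Fin d)}
    (h : ∀ v, edgeDiv E v + T.count v = 1) : T.card = d := by
  have sum_count : ∑ v, T.count v = T.card :=
    Multiset.sum_count_eq_card fun _ _ => Finset.mem_univ _
  have sum_eq : ∑ v, (edgeDiv E v + T.count v) = d := by simp [h]
  rw [Finset.sum_add_distrib, sum_edgeDiv, zero_add, ← Nat.cast_sum, sum_count] at sum_eq
  exact_mod_cast sum_eq

theorem IsWord.exists_marking {D : FloorDiagram d} {W : Fin d → List (Black d)}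
    (hW : IsWord D W) : ∃ M : D.Marking, List.ofFn M.word = wordList W := by
  obtain ⟨t, ht⟩ := exists_map_univ_eq (card_eq_of_edgeDiv_add_count hW.div_eq)
  have hmap : Finset.univ.val.map (D.label t) = (wordList W : Multiset (Letter d)) := by
    rw [map_label, coe_wordList, ht, ← hW.edges_eq, map_edgesOf_add_map_endsOf]
  obtain ⟨pos, hpos⟩ := exists_equiv_ofFn_eq hmap
  have hbefore := (pairwise_before_wordList W).2 hW.fits
  rw [← hpos, List.pairwise_ofFn] at hbefore
  have pos_lt : ∀ x y, x ≠ y → ¬ Before (D.label t y) (D.label t x) → pos x < pos y := by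
    intro x y hne hnot
    refine (pos.injective.ne hne).lt_or_gt.resolve_right fun hlt => hnot ?_
    simpa using hbefore hlt
  refine ⟨⟨t, fun v => ?_, pos, fun v w hvw => ?_, fun e => ?_, fun e => ?_, fun i => ?_⟩, hpos⟩
  · rw [← count_map_univ, ht]
    exact hW.div_eq v
  · exact pos_lt _ _ (fun h => hvw.ne (Sum.inl.inj h)) (lt_asymm hvw)
  · exact pos_lt _ _ (by simp) (lt_irrefl e.1.src)
  · exact pos_lt _ _ (by simp) (lt_irrefl e.1.tgt)
  · exact pos_lt _ _ (by simp) (lt_irrefl (t i))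

theorem nu_eq_card (D : FloorDiagram d) : D.nu = Nat.card {W // IsWord D W} := by
  choose F isWord_F wordList_F using fun M : D.Marking => M.exists_word
  refine Nat.card_congr (Equiv.ofBijective
    (Quotient.lift (fun M => (⟨F M, isWord_F M⟩ : {W // IsWord D W})) fun M M' h => ?_) ⟨?_, ?_⟩)
  · refine Subtype.ext (wordList_injective ?_)
    rw [wordList_F, wordList_F, Marking.equiv_iff.1 h]
  · rintro ⟨M⟩ ⟨M'⟩ h
    refine Quotient.sound (Marking.equiv_iff.2 (List.ofFn_injective ?_))
    rw [← wordList_F, ← wordList_F]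
    exact congrArg (fun W => wordList W.1) h
  · rintro ⟨W, hW⟩
    obtain ⟨M, hM⟩ := hW.exists_marking
    exact ⟨Quotient.mk _ M, Subtype.ext (wordList_injective ((wordList_F M).trans hM))⟩

end FloorDiagram

/-! ### Words as configurations of segments -/

namespace FloorDiagram

variable {d : ℕ}

/-- The segment that corresponds to a black vertex between the white vertices `k - 1` and `k`. -/
def toSegment (k : Fin d) : Black d → Segment
  | Sum.inl e => ⟨k - 1 - e.src, e.tgt - k, e.wt⟩
  | Sum.inr t => ⟨k, t - k, 1⟩

theorem toSegment_injOn (k : Fin d) : Set.InjOn (toSegment k) {b | Fits k b} := by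
  rintro (e | t) hb (e' | t') hb' h <;>
    simp only [toSegment, Segment.mk.injEq, Set.mem_ofPred_eq, Fits, Fin.lt_def, Fin.le_def]
      at h hb hb'
  · exact congrArg Sum.inl (WEdge.ext (by omega) (by omega) h.2.2)
  · omega
  · omega
  · exact congrArg Sum.inr (by omega)

theorem toSegment_bounds {k : Fin d} {b : Black d} (h : Fits k b) :
    (toSegment k b).right ≤ k.rev ∧ (toSegment k b).left ≤ d - 1 - k.rev ∧
      ((toSegment k b).left = d - 1 - k.rev → (toSegment k b).weight = 1) := by
  rcases b with e | t <;>
    simp only [toSegment, Fits, Fin.lt_def, Fin.le_def, Fin.val_rev, implies_true, and_true]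
      at h ⊢ <;> omega

theorem exists_toSegment_eq {k : Fin d} {x : Segment} (hright : x.right ≤ k.rev)
    (hleft : x.left ≤ d - 1 - k.rev) (hend : x.left = d - 1 - k.rev → x.weight = 1) :
    ∃ b, Fits k b ∧ toSegment k b = x := by
  rw [Fin.val_rev] at hright hleft hend
  rcases lt_or_ge x.left k with hlt | hge
  · refine ⟨Sum.inl ⟨⟨k - 1 - x.left, by omega⟩, ⟨k + x.right, by omega⟩, x.weight⟩, ⟨?_, ?_⟩,
      Segment.ext ?_ ?_ rfl⟩ <;> simp only [toSegment, Fin.lt_def, Fin.le_def] <;> omega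
  · refine ⟨Sum.inr ⟨k + x.right, by omega⟩, ?_, Segment.ext ?_ ?_ (hend (by omega)).symm⟩ <;>
      simp only [toSegment, Fits, Fin.le_def] <;> omega

/-- The weight of the edges at a black vertex. -/
def blackWeight : Black d → ℕ
  | Sum.inl e => e.wt
  | Sum.inr _ => 1

/-- The weight with which an edge with a black vertex on it crosses the gap in front of the white
vertex `g`. -/
def blackCross : Black d → ℕ → ℕ
  | Sum.inl e, g => if e.src < g ∧ g ≤ e.tgt then e.wt else 0
  | Sum.inr t, g => if g ≤ t then 1 else 0

theorem weight_toSegment (k : Fin d) (b : Black d) : (toSegment k b).weight = blackWeight b := by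
  cases b <;> rfl

theorem cross_toSegment {k : Fin d} {b : Black d} (h : Fits k b) (g : Fin d) :
    (toSegment k b).cross k.rev g = blackCross b g.rev := by
  rcases b with e | t <;>
    simp only [toSegment, Segment.cross, blackCross, Fits, Fin.lt_def, Fin.le_def, Fin.val_rev]
      at h ⊢ <;>
    exact if_congr (by omega) rfl rfl

theorem area_toSegment {k : Fin d} {b : Black d} (h : Fits k b) :
    (toSegment k b).area = ∑ g : Fin d, blackCross b g := by
  rcases b with e | t <;> simp only [toSegment, Segment.area, blackCross, ← Finset.sum_filter,
    Finset.sum_const, smul_eq_mul, mul_one, one_mul]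
  · have card_gaps : (Finset.univ.filter fun g : Fin d => (e.src : ℕ) < g ∧ (g : ℕ) ≤ e.tgt).card =
        e.tgt - e.src := by
      rw [← Fin.card_Ioc]
      congr 1
      ext g
      simp
    have hsrc : (e.src : ℕ) < k := h.1
    have htgt : (k : ℕ) ≤ e.tgt := h.2
    rw [card_gaps, mul_comm]
    congr 1
    omega
  · have card_gaps : (Finset.univ.filter fun g : Fin d => (g : ℕ) ≤ t).card = t + 1 := by
      rw [← Fin.card_Iic]
      congr 1
      ext g
      simp
    have htgt : (k : ℕ) ≤ t := h
    omega

/-- The total weight with which edges with the given black vertices on them cross the gap in front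
of the white vertex `g`. -/
def totalBlackCross (B : Multiset (Black d)) (g : ℕ) : ℕ := (B.map fun b => blackCross b g).sum

theorem totalBlackCross_cons (b : Black d) (B : Multiset (Black d)) (g : ℕ) :
    totalBlackCross (b ::ₘ B) g = blackCross b g + totalBlackCross B g := by
  rw [totalBlackCross, Multiset.map_cons, Multiset.sum_cons, totalBlackCross]

theorem totalBlackCross_self (B : Multiset (Black d)) : totalBlackCross B d = 0 := by
  refine Multiset.sum_eq_zero fun x hx => ?_
  obtain ⟨e | t, -, rfl⟩ := Multiset.mem_map.1 hx
  · exact if_neg fun h => absurd e.tgt.2 (by omega)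
  · exact if_neg fun h => absurd t.2 (by omega)

theorem mem_edgesOf {e : WEdge d} {B : Multiset (Black d)} :
    e ∈ edgesOf B ↔ Sum.inl e ∈ B := by
  simp [edgesOf, Multiset.mem_filterMap]

theorem totalBlackCross_sub_succ {B : Multiset (Black d)}
    (hB : ∀ e, Sum.inl e ∈ B → e.src < e.tgt) (v : Fin d) :
    (totalBlackCross B v : ℤ) - totalBlackCross B (v + 1) =
      edgeDiv (edgesOf B) v + (endsOf B).count v := by
  induction B using Multiset.induction_on with
  | empty => simp [totalBlackCross, edgeDiv, edgesOf, endsOf]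
  | cons b B ih =>
    have ih := ih fun e he => hB e (Multiset.mem_cons_of_mem he)
    rw [totalBlackCross_cons, totalBlackCross_cons]
    rcases b with e | t
    · have src_lt_tgt : (e.src : ℕ) < e.tgt := hB e (Multiset.mem_cons_self _ B)
      have cross_sub : (blackCross (Sum.inl e) v : ℤ) - blackCross (Sum.inl e) (v + 1) =
          (if e.tgt = v then (e.wt : ℤ) else 0) - if e.src = v then (e.wt : ℤ) else 0 := by
        simp only [blackCross, Fin.ext_iff]
        split_ifs <;> omega
      rw [edgesOf_cons_inl, endsOf_cons_inl, edgeDiv_cons]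
      push_cast
      linarith
    · have cross_sub : (blackCross (Sum.inr t) v : ℤ) - blackCross (Sum.inr t) (v + 1) =
          if v = t then 1 else 0 := by
        simp only [blackCross, Fin.ext_iff]
        split_ifs <;> omega
      rw [edgesOf_cons_inr, endsOf_cons_inr, Multiset.count_cons]
      push_cast
      linarith

theorem forall_sub_succ_eq_one_iff {f : ℕ → ℤ} (hf : f d = 0) :
    (∀ v : Fin d, f v - f (v + 1) = 1) ↔ ∀ g : Fin d, f g.rev = g + 1 := by
  have hrev : ∀ g : Fin d, (g.rev : ℤ) + (g + 1) = d := fun g => by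
    rw [Fin.val_rev]
    omega
  constructor
  · intro h g
    have eq_sub : ∀ n (_ : n ≤ d), f n = d - n := fun n hn => by
      induction hn using Nat.decreasingInduction with
      | self => rw [hf, sub_self]
      | of_succ n hn ih =>
        have hsub := h ⟨n, hn⟩
        push_cast at ih hsub
        linarith
    linarith [eq_sub _ g.rev.2.le, hrev g]
  · intro h v
    have eq_sub : ∀ n ≤ d, f n = d - n := fun n hn => by
      rcases hn.lt_or_eq with hlt | rfl
      · have hn := h (Fin.rev ⟨n, hlt⟩)
        rw [Fin.rev_rev] at hn
        linarith [hrev ⟨n, hlt⟩]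
      · rw [hf, sub_self]
    rw [eq_sub _ v.2.le, eq_sub _ v.2]
    push_cast
    ring

/-- The configuration that corresponds to a word. As its gaps are numbered from the target side, the
order is reversed. -/
def toConfig (W : Fin d → List (Black d)) (i : Fin d) : List Segment :=
  (W i.rev).map (toSegment i.rev)

section Word

variable {W : Fin d → List (Black d)} (hW : ∀ k, ∀ b ∈ W k, Fits k b)

include hW

@[to_additive]
theorem prod_toConfig {N : Type*} [CommMonoid N] (φ : Fin d → Segment → N) (ψ : Black d → N)
    (h : ∀ k b, Fits k b → φ k.rev (toSegment k b) = ψ b) :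
    ∏ i, ((toConfig W i).map (φ i)).prod = ((blacks W).map ψ).prod := by
  have prod_rev : ∀ k : Fin d, ((toConfig W k.rev).map (φ k.rev)).prod = ((W k).map ψ).prod :=
    fun k => by
      rw [toConfig, List.map_map, Fin.rev_rev]
      exact congrArg _ (List.map_congr_left fun b hb => h k b (hW k b hb))
  rw [← Equiv.prod_comp Fin.revPerm, blacks, ← Multiset.coe_mapAddMonoidHom, map_sum,
    Multiset.prod_sum]
  exact Finset.prod_congr rfl fun k _ => prod_rev k

theorem sum_listCross_toConfig (g : Fin d) :
    ∑ i : Fin d, Segment.listCross (toConfig W i) i g = totalBlackCross (blacks W) g.rev :=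
  sum_toConfig hW (fun i x => x.cross i g) (fun b => blackCross b g.rev)
    fun _ _ h => cross_toSegment h g

theorem prod_listVal_toConfig (f : ℕ → ℚ) :
    ∏ i, Segment.listVal f (toConfig W i) = ((blacks W).map fun b => f (blackWeight b)).prod :=
  prod_toConfig hW (fun _ x => f x.weight) (fun b => f (blackWeight b))
    fun k b _ => by rw [weight_toSegment]

theorem src_lt_tgt_of_mem_blacks {e : WEdge d} (he : Sum.inl e ∈ blacks W) : e.src < e.tgt := by
  obtain ⟨k, -, hk⟩ := Multiset.mem_sum.1 he
  exact (hW k _ hk).1.trans_le (hW k _ hk).2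

theorem edgeDiv_add_count_eq_one_iff :
    (∀ v, edgeDiv (edgesOf (blacks W)) v + (endsOf (blacks W)).count v = 1) ↔
      ∀ g : Fin d, ∑ i : Fin d, Segment.listCross (toConfig W i) i g = g + 1 := by
  simp only [← totalBlackCross_sub_succ fun _ => src_lt_tgt_of_mem_blacks hW,
    sum_listCross_toConfig hW]
  refine (forall_sub_succ_eq_one_iff (f := fun g => totalBlackCross (blacks W) g) ?_).trans
    (forall_congr' fun g => by norm_cast)
  rw [totalBlackCross_self, Nat.cast_zero]

theorem sum_listExcess_add_card (hweight : ∀ b ∈ blacks W, 0 < blackWeight b) :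
    ∑ i, Segment.listExcess (toConfig W i) + (blacks W).card =
      ∑ g : Fin d, totalBlackCross (blacks W) g := by
  have sum_excess : ∑ i, Segment.listExcess (toConfig W i) =
      ((blacks W).map fun b => ∑ g : Fin d, blackCross b g - 1).sum :=
    sum_toConfig hW (fun _ x => x.excess) (fun b => ∑ g : Fin d, blackCross b g - 1)
      fun _ _ h => by rw [Segment.excess, area_toSegment h]
  have cross_pos : ∀ b ∈ blacks W, 1 ≤ ∑ g : Fin d, blackCross b g := fun b hb => by
    obtain ⟨k, -, hk⟩ := Multiset.mem_sum.1 hb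
    rw [← area_toSegment (hW k b hk), Segment.area, weight_toSegment]
    exact Nat.mul_pos (hweight b hb) (Nat.succ_pos _)
  simp only [totalBlackCross]
  rw [sum_excess, ← Multiset.sum_map_sum, ← mul_one (blacks W).card, ← smul_eq_mul,
    ← Multiset.sum_replicate, ← Multiset.map_const', ← Multiset.sum_map_add]
  exact congrArg _ (Multiset.map_congr rfl fun b hb => Nat.sub_add_cancel (cross_pos b hb))

end Word

theorem exists_toConfig_eq {ω : Fin d → List Segment}
    (h : ∀ i : Fin d, ∀ x ∈ ω i, x.right ≤ i ∧ x.left ≤ d - 1 - i ∧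
      (x.left = d - 1 - i → x.weight = 1)) :
    ∃ W, (∀ k, ∀ b ∈ W k, Fits k b) ∧ toConfig W = ω := by
  have exists_list : ∀ k, ∃ L : List {b : Black d // Fits k b},
      L.map (toSegment k ∘ Subtype.val) = ω k.rev := fun k => by
    rw [← Set.mem_range, Set.range_list_map]
    intro x hx
    obtain ⟨hright, hleft, hend⟩ := h k.rev x hx
    obtain ⟨b, hb, rfl⟩ := exists_toSegment_eq hright hleft hend
    exact ⟨⟨b, hb⟩, rfl⟩
  choose L hL using exists_list
  refine ⟨fun k => (L k).map Subtype.val, fun k b hb => ?_, funext fun i => ?_⟩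
  · obtain ⟨b, -, rfl⟩ := List.mem_map.1 hb
    exact b.2
  · have hi := hL i.rev
    rw [Fin.rev_rev] at hi
    rw [← hi, toConfig, List.map_map]

theorem toConfig_injOn :
    Set.InjOn toConfig {W : Fin d → List (Black d) | ∀ k, ∀ b ∈ W k, Fits k b} := by
  intro W hW W' hW' h
  funext k
  have hk : (W k).map (toSegment k) = (W' k).map (toSegment k) := by
    simpa only [toConfig, Fin.rev_rev] using congrFun h k.rev
  lift W k to List {b // Fits k b} using hW k with L
  lift W' k to List {b // Fits k b} using hW' k with L'
  rw [List.map_map, List.map_map] at hk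
  exact congrArg _ (List.map_injective_iff.2 (toSegment_injOn k).injective hk)

theorem two_mul_sum_succ (d : ℕ) : 2 * ∑ g : Fin d, ((g : ℕ) + 1) = d * (d + 1) := by
  induction d with
  | zero => rfl
  | succ d ih =>
    simp only [Fin.sum_univ_castSucc, Fin.val_castSucc, Fin.val_last, mul_add, ih]
    ring

namespace IsWord

variable {D : FloorDiagram d} {W : Fin d → List (Black d)}

theorem blackWeight_pos (hW : IsWord D W) {b : Black d} (hb : b ∈ blacks W) :
    0 < blackWeight b := by
  rcases b with e | t
  · exact D.wt_pos e (hW.edges_eq ▸ mem_edgesOf.2 hb)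
  · exact one_pos

theorem sum_listCross (hW : IsWord D W) (g : Fin d) :
    ∑ i : Fin d, Segment.listCross (toConfig W i) i g = g + 1 :=
  (edgeDiv_add_count_eq_one_iff hW.fits).1 (by rw [hW.edges_eq]; exact hW.div_eq) g

theorem card_blacks (hW : IsWord D W) : (blacks W).card = D.edges.card + d := by
  rw [← map_edgesOf_add_map_endsOf (blacks W), Multiset.card_add, Multiset.card_map,
    Multiset.card_map, hW.edges_eq, card_eq_of_edgeDiv_add_count hW.div_eq]

theorem excess_eq_cogenus (hW : IsWord D W) :
    ((∑ i, Segment.listExcess (toConfig W i) : ℕ) : ℤ) = D.cogenus := by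
  have sum_cross : ∑ g : Fin d, totalBlackCross (blacks W) g = ∑ g : Fin d, ((g : ℕ) + 1) := by
    rw [← Equiv.sum_comp Fin.revPerm]
    exact Finset.sum_congr rfl fun g _ =>
      (sum_listCross_toConfig hW.fits g).symm.trans (hW.sum_listCross g)
  have excess_add_card := sum_listExcess_add_card hW.fits fun _ => hW.blackWeight_pos
  rw [hW.card_blacks, sum_cross] at excess_add_card
  have gauss : 2 * ((∑ g : Fin d, ((g : ℕ) + 1) : ℕ) : ℤ) = (d : ℤ) * (d + 1) := by
    exact_mod_cast two_mul_sum_succ d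
  have triangle : ((d : ℤ) - 1) * (d - 2) / 2 = ((d : ℤ) * (d + 1) - 4 * d + 2) / 2 := by
    congr 1
    ring
  rw [cogenus, genus, triangle]
  omega

theorem isConfig (hW : IsWord D W) {δ : ℕ} (hD : D.cogenus = δ) :
    IsConfig d δ (toConfig W) := by
  refine ⟨fun i x hx => ?_, hW.sum_listCross, by exact_mod_cast hW.excess_eq_cogenus.trans hD⟩
  obtain ⟨b, hb, rfl⟩ := List.mem_map.1 hx
  have bounds := toSegment_bounds (hW.fits _ b hb)
  rw [Fin.rev_rev] at bounds
  rw [weight_toSegment] at bounds ⊢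
  exact ⟨hW.blackWeight_pos (Multiset.mem_sum.2 ⟨i.rev, Finset.mem_univ _, hb⟩), bounds⟩

theorem prod_listVal (hW : IsWord D W) {f : ℕ → ℚ} (hf : f 1 = 1) :
    ∏ i, Segment.listVal f (toConfig W i) = (D.edges.map fun e => f e.wt).prod := by
  rw [prod_listVal_toConfig hW.fits, ← map_edgesOf_add_map_endsOf (blacks W), hW.edges_eq]
  simp [blackWeight, hf]

end IsWord

theorem exists_isWord {δ : ℕ} {ω : Fin d → List Segment} (hω : IsConfig d δ ω) :
    ∃ (D : FloorDiagram d) (W : Fin d → List (Black d)), D.cogenus = δ ∧ IsWord D W ∧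
      toConfig W = ω := by
  obtain ⟨W, fits, rfl⟩ := exists_toConfig_eq fun i x hx => (hω.segment i x hx).2
  have div_eq := (edgeDiv_add_count_eq_one_iff fits).2 hω.cross
  let D : FloorDiagram d :=
    { edges := edgesOf (blacks W)
      src_lt_tgt := fun _ he => src_lt_tgt_of_mem_blacks fits (mem_edgesOf.1 he)
      wt_pos := fun e he => by
        obtain ⟨k, -, hk⟩ := Multiset.mem_sum.1 (mem_edgesOf.1 he)
        refine (hω.segment k.rev (toSegment k (Sum.inl e)) ?_).1
        rw [toConfig, Fin.rev_rev]
        exact List.mem_map_of_mem hk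
      div_le := fun v => by linarith [div_eq v] }
  have isWord : IsWord D W := ⟨fits, rfl, div_eq⟩
  exact ⟨D, W, by rw [← isWord.excess_eq_cogenus, hω.excess], isWord, rfl⟩

/-- A floor diagram of cogenus `δ` together with a word that encodes one of its markings. -/
abbrev WordOfCogenus (d δ : ℕ) : Type :=
  Σ D : {D : FloorDiagram d // D.cogenus = δ}, {W // IsWord D.1 W}

/-- The correspondence between marked floor diagrams and configurations of segments. -/
noncomputable def equivConfigs (d δ : ℕ) : WordOfCogenus d δ ≃ configs d δ :=
  Equiv.ofBijective (fun w => ⟨toConfig w.2.1, mem_configs.2 (w.2.2.isConfig w.1.2)⟩) <| by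
    constructor
    · rintro ⟨⟨D, hD⟩, W, hW⟩ ⟨⟨D', hD'⟩, W', hW'⟩ h
      obtain rfl : W = W' := toConfig_injOn hW.fits hW'.fits (congrArg Subtype.val h)
      obtain rfl : D = D' := FloorDiagram.ext (hW.edges_eq.symm.trans hW'.edges_eq)
      rfl
    · rintro ⟨ω, hω⟩
      obtain ⟨D, W, hD, hW, rfl⟩ := exists_isWord (mem_configs.1 hω)
      exact ⟨⟨⟨D, hD⟩, W, hW⟩, rfl⟩

theorem weightedCount_eq_sum_configs {f : ℕ → ℚ} (hf : f 1 = 1) (δ d : ℕ) :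
    weightedCount f δ d = ∑ ω ∈ configs d δ, ∏ i, Segment.listVal f (ω i) := by
  have finite_words : ∀ D : {D : FloorDiagram d // D.cogenus = (δ : ℤ)},
      Finite {W // IsWord D.1 W} := fun D =>
    Finite.of_injective (fun W => equivConfigs d δ ⟨D, W⟩)
      ((equivConfigs d δ).injective.comp sigma_mk_injective)
  have := fun D : {D : FloorDiagram d // D.cogenus = (δ : ℤ)} =>
    Fintype.ofFinite {W // IsWord D.1 W}
  rw [weightedCount, ← Finset.sum_coe_sort (configs d δ), ← (equivConfigs d δ).sum_comp,
    Fintype.sum_sigma,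
    Finset.sum_subtype (p := fun D : FloorDiagram d => D.cogenus = (δ : ℤ)) _ (by simp)]
  refine Finset.sum_congr rfl fun D _ => ?_
  have prod_eq : ∀ W : {W // IsWord D.1 W},
      ∏ i, Segment.listVal f ((equivConfigs d δ ⟨D, W⟩).1 i) =
        (D.1.edges.map fun e => f e.wt).prod := fun W => W.2.prod_listVal hf
  rw [Finset.sum_congr rfl fun W _ => prod_eq W, Finset.sum_const, nsmul_eq_mul, nu_eq_card,
    Nat.card_eq_fintype_card, Finset.card_univ]

theorem eventuallyPoly_weightedCount {f : ℕ → ℤ} (hf : f 1 = 1) (δ : ℕ) :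
    EventuallyPoly (fun d => (weightedCount f δ d : ℤ)) (2 * δ)
      (((f 2 + 2) / 2) ^ δ / δ.factorial) := by
  have cast_one : (f 1 : ℚ) = 1 := by rw [hf, Int.cast_one]
  have cast_eq : ∀ d, ((weightedCount f δ d : ℤ) : ℚ) = weightedCount (fun w => (f w : ℚ)) δ d :=
    map_weightedCount (Int.castRingHom ℚ) f δ
  simpa only [cast_eq, weightedCount_eq_sum_configs (f := fun w => (f w : ℚ)) cast_one] using
    eventuallyPoly_sum_configs (f := fun w => (f w : ℚ)) cast_one δ

theorem eventuallyPoly_weightedCount_sq (δ : ℕ) :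
    EventuallyPoly (fun d => (weightedCount (fun w => (w : ℤ) ^ 2) δ d : ℤ)) (2 * δ)
      (3 ^ δ / δ.factorial) := by
  convert eventuallyPoly_weightedCount (f := fun w => (w : ℤ) ^ 2) (by norm_num) δ using 3
  norm_num

theorem eventuallyPoly_weightedCount_odd (δ : ℕ) :
    EventuallyPoly (fun d => (weightedCount (fun w => if Odd w then (1 : ℤ) else 0) δ d : ℤ))
      (2 * δ) (1 / δ.factorial) := by
  have hf : (if Odd 1 then (1 : ℤ) else 0) = 1 := if_pos odd_one
  convert eventuallyPoly_weightedCount (f := fun w => if Odd w then (1 : ℤ) else 0) hf δ using 2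
  rw [if_neg (by decide), Int.cast_zero, zero_add, div_self two_ne_zero, one_pow]

end FloorDiagram

theorem theorem5p9 (K : Type*) [Field K] [CharZero K] (δ : ℕ) :
    ∃ P Q : Polynomial ℚ,
      P.natDegree = 2 * δ ∧ Q.degree = ((2 * δ : ℕ) : WithBot ℕ) ∧
      ∃ d₀ : ℕ, ∀ d : ℕ, d₀ ≤ d →
        ∃ p q : ℤ, P.eval (d : ℚ) = (p : ℚ) ∧ Q.eval (d : ℚ) = (q : ℚ) ∧
          arithmeticCount K δ d = p • GW.hyp K + q • GW.diag (1 : Kˣ) := by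
  have rank_poly := FloorDiagram.eventuallyPoly_weightedCount_sq δ
  have signature_poly := FloorDiagram.eventuallyPoly_weightedCount_odd δ
  obtain ⟨P, natDegree_P, coeff_P, eval_P⟩ := (rank_poly.sub signature_poly).const_mul (1 / 2)
  obtain ⟨Q, natDegree_Q, coeff_Q, eval_Q⟩ := signature_poly
  refine ⟨P, Q, ?_, ?_, ?_⟩
  · rcases δ.eq_zero_or_pos with rfl | hδ
    · exact Nat.le_zero.1 natDegree_P
    · have gap_pos : (0 : ℚ) < 3 ^ δ - 1 := sub_pos.2 (one_lt_pow₀ (by norm_num) hδ.ne')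
      refine Polynomial.natDegree_eq_of_le_of_coeff_ne_zero natDegree_P ?_
      rw [coeff_P, ← sub_div]
      positivity
  · refine Polynomial.degree_eq_of_le_of_coeff_ne_zero
      (Polynomial.degree_le_of_natDegree_le natDegree_Q) ?_
    rw [coeff_Q]
    positivity
  · obtain ⟨d₀, hd₀⟩ := Filter.eventually_atTop.1 (eval_P.and eval_Q)
    refine ⟨d₀, fun d hd => ?_⟩
    obtain ⟨p, rank_eq, count_eq⟩ := hasRankSignature_arithmeticCount K δ d
    refine ⟨p, _, ?_, (hd₀ d hd).2.symm, count_eq⟩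
    rw [← (hd₀ d hd).1]
    simp only [← rank_eq]
    push_cast
    ring
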